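/- Let $\mathcal Z\subset\mathbb R^N$ be a convex body (compact, convex, with non-empty interior). Let $\|\cdot\|$ be any norm on $\mathbb R^N$, let $j:\mathbb R_{\ge0}\to\mathbb R_{\ge0}$ be a bijection, continuous with continuous inverse, with $j(0)=0$, and put $\delta(z,\tilde z)=j(\|z-\tilde z\|)$ (so $\delta$ is the metric induced by the norm if $j=\mathrm{id}$, and a semi-metric in general). Let $\mathcal X\subseteq\mathbb R^K$ and let $g:\mathcal Z\to\mathcal X$ be differentiable and injective. Let $p_{\mathsf{data}}$ be the law of $x=g(z)$ with $z$ uniform on $\mathcal Z$, and let $p_{\mathsf{pos}}$ be the law of $(x,\tilde x)=(g(z),g(\tilde z))$, where $\tilde z$ is uniform on $\mathcal Z$ and, given $\tilde z$, the point $z$ has density $$p(z\mid\tilde z)=C_p(\tilde z)^{-1}e^{-\delta(z,\tilde z)},\qquad C_p(\tilde z)=\int_{\mathcal Z}e^{-\delta(w,\tilde z)}\,dw,$$ on $\mathcal Z$. Fix $\tau>0$. For $h:\mathcal Z\to\mathcal Z$ let $$q_h(z\mid\tilde z)=C_q(\tilde z)^{-1}e^{-\delta(h(z),h(\tilde z))/\tau},\qquad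 C_q(\tilde z)=\int_{\mathcal Z}e^{-\delta(h(w),h(\tilde z))/\tau}\,dw,$$ and assume that the model can match the ground truth, i.e. $q_{h_0}(z\mid\tilde z)=p(z\mid\tilde z)$ for all $z,\tilde z\in\mathcal Z$, for some map $h_0:\mathcal Z\to\mathcal Z$ (for $\tau=1$ this holds with $h_0=\mathrm{id}$). For $f:\mathcal X\to\mathcal Z$ and $M\in\mathbb N$ let $$\mathcal L_{\delta\text{-}\mathsf{contr}}(f;\tau,M)=\mathbb E\left[-\log\frac{e^{-\delta(f(x),f(\tilde x))/\tau}}{e^{-\delta(f(x),f(\tilde x))/\tau}+\sum_{i=1}^M e^{-\delta(f(x_i^-),f(\tilde x))/\tau}}\right],$$ where $(x,\tilde x)\sim p_{\mathsf{pos}}$ and, independently, $x_1^-,\dots,x_M^-$ are i.i.d. with law $p_{\mathsf{data}}$. Suppose that $f:\mathcal X\to\mathcal Z$ is differentiable and minimizes $\mathcal L_{\delta\text{-}\mathsf{contr}}$ for $M\to\infty$ among differentiable maps, i.e. $\limsup_{M\to\infty}\big(\mathcal L_{\delta\text{-}\mathsf{contr}}(f;\tau,M)-\mathcal L_{\delta\text{-}\mathsf{contr}}(f';\tau,M)\big)\le0$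 for every differentiable $f':\mathcal X\to\mathcal Z$. Then $h=f\circ g$ is invertible and affine: it is the restriction to $\mathcal Z$ of an invertible affine map of $\mathbb R^N$. If moreover $\tau=1$, then $h$ is a bijection of $\mathcal Z$ onto $\mathcal Z$. -/

import Mathlib

open MeasureTheory Filter Set
open scoped NNReal ENNReal Topology

noncomputable section

namespace ContrastiveICA

/-- The space `ℝ^n`. -/
abbrev Rn (n : ℕ) : Type := EuclideanSpace ℝ (Fin n)

/-- The (semi-)metric `δ = j ∘ d`, where `d(x, y) = ‖x - y‖` is the metric induced by a norm `nrm`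
on `ℝ^N` and `j : ℝ≥0 → ℝ≥0` is continuously invertible. For `j = id` it is the metric itself. -/
def semimetric {N : ℕ} (nrm : Seminorm ℝ (Rn N)) (j : ℝ≥0 ≃ₜ ℝ≥0) (x y : Rn N) : ℝ :=
  (j ⟨nrm (x - y), apply_nonneg nrm (x - y)⟩ : ℝ)

/-- The uniform distribution on `Z`, i.e. the marginal with density `p(z) = |Z|⁻¹` on `Z`. -/
def uniform {N : ℕ} (Z : Set (Rn N)) : Measure (Rn N) :=
  ProbabilityTheory.cond volume Z

/-- The ground-truth conditional density on `Z`: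
`p(z | z') = C_p(z')⁻¹ exp (-δ(z, z'))` with `C_p(z') = ∫_Z exp (-δ(w, z')) dw`. -/
def trueDensity {N : ℕ} (Z : Set (Rn N)) (δ : Rn N → Rn N → ℝ) (z z' : Rn N) : ℝ :=
  (∫ w in Z, Real.exp (-δ w z'))⁻¹ * Real.exp (-δ z z')

/-- The model conditional density on `Z` attached to `h`:
`q_h(z | z') = C_q(z')⁻¹ exp (-δ(h z, h z') / τ)` with
`C_q(z') = ∫_Z exp (-δ(h w, h z') / τ) dw`. -/
def modelDensity {N : ℕ} (Z : Set (Rn N)) (δ : Rn N → Rn N → ℝ) (τ : ℝ) (h : Rn N → Rn N)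
    (z z' : Rn N) : ℝ :=
  (∫ w in Z, Real.exp (-δ (h w) (h z') / τ))⁻¹ * Real.exp (-δ (h z) (h z') / τ)

/-- The law of a positive pair of latents `(z, z')`: `z'` is uniform on `Z` and, given `z'`,
`z` has density `p(z | z')` on `Z`. -/
def latentPair {N : ℕ} (Z : Set (Rn N)) (δ : Rn N → Rn N → ℝ) : Measure (Rn N × Rn N) :=
  ((volume.restrict Z).prod (uniform Z)).withDensity
    (fun w => ENNReal.ofReal (trueDensity Z δ w.1 w.2))

/-- `p_data`: the law of an observation `x = g z`, with `z` uniform on `Z`. -/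
def pData {N K : ℕ} (Z : Set (Rn N)) (g : Rn N → Rn K) : Measure (Rn K) :=
  (uniform Z).map g

/-- `p_pos`: the law of a positive pair of observations `(x, x') = (g z, g z')`. -/
def pPos {N K : ℕ} (Z : Set (Rn N)) (δ : Rn N → Rn N → ℝ) (g : Rn N → Rn K) :
    Measure (Rn K × Rn K) :=
  (latentPair Z δ).map (Prod.map g g)

/-- The contrastive loss with `M` negative samples: the expectation, over a positive pair
`(x, x')` and independent i.i.d. negatives `x⁻_1, …, x⁻_M` with law `p_data`, of
`-log (e^{-δ(f x, f x')/τ} / (e^{-δ(f x, f x')/τ} + ∑ i, e^{-δ(f x⁻_i, f x')/τ}))`. -/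
def contrastiveLoss {N K : ℕ} (Z : Set (Rn N)) (δ : Rn N → Rn N → ℝ) (g : Rn N → Rn K) (τ : ℝ)
    (f : Rn K → Rn N) (M : ℕ) : ℝ :=
  ∫ s : (Rn K × Rn K) × (Fin M → Rn K),
    -Real.log (Real.exp (-δ (f s.1.1) (f s.1.2) / τ) /
      (Real.exp (-δ (f s.1.1) (f s.1.2) / τ)
        + ∑ i : Fin M, Real.exp (-δ (f (s.2 i)) (f s.1.2) / τ)))
    ∂((pPos Z δ g).prod (Measure.pi fun _ : Fin M => pData Z g))

/-- The encoders: differentiable maps `f : X → Z`, where `X ⊆ ℝ^K` is the observation space. -/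
def IsEncoder {N K : ℕ} (X : Set (Rn K)) (Z : Set (Rn N)) (f : Rn K → Rn N) : Prop :=
  MapsTo f X Z ∧ DifferentiableOn ℝ f X

/-- The encoder `f` minimizes the contrastive loss as `M → ∞`: against every encoder `f'`,
`limsup_M (L(f; τ, M) - L(f'; τ, M)) ≤ 0`. The normalization `- log M` of the losses cancels;
if `L(f; τ, M) - log M` and `L(f'; τ, M) - log M` converge, this compares their limits. -/
def MinimizesLimitLoss {N K : ℕ} (X : Set (Rn K)) (Z : Set (Rn N)) (δ : Rn N → Rn N → ℝ)
    (g : Rn N → Rn K) (τ : ℝ) (f : Rn K → Rn N) : Prop :=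
  IsEncoder X Z f ∧ ∀ f' : Rn K → Rn N, IsEncoder X Z f' → ∀ ε : ℝ, 0 < ε →
    ∀ᶠ M : ℕ in atTop, contrastiveLoss Z δ g τ f M ≤ contrastiveLoss Z δ g τ f' M + ε

/-- The model can match the ground truth: for some self-map `h₀` of `Z`, the model conditional
`q_{h₀}` equals the ground-truth conditional `p`. For `τ = 1` the identity is such a map. -/
def ModelMatches {N : ℕ} (Z : Set (Rn N)) (δ : Rn N → Rn N → ℝ) (τ : ℝ) : Prop :=
  ∃ h₀ : Rn N → Rn N, MapsTo h₀ Z Z ∧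
    ∀ z ∈ Z, ∀ z' ∈ Z, modelDensity Z δ τ h₀ z z' = trueDensity Z δ z z'

end ContrastiveICA

end

namespace ContrastiveICA

/-! After subtracting `log M`, the law of large numbers gives the loss of `f` a limit that depends
only on `h = f ∘ g` (`tendsto_contrastiveLoss`). This limit is the cross-entropy of the model
density `q_h` relative to the true density `p`, both taken with respect to the uniform law. By
Gibbs' inequality it is at least the entropy of `p`, with equality only if `q_h = p` almost
everywhere (`simDensity_ae_eq_of_limitLoss_le`). A minimizer must reach this bound: the ideal
encoder `h₀ ∘ g⁻¹` attains it, and although it may fail to be differentiable, it is continuous on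
the compact set `g '' Z` and is a uniform limit of differentiable maps into `Z`
(`limitLoss_le_of_minimizes`). Hence `q_h = p`, everywhere on `Z` by continuity, and comparison with
the diagonal removes the normalizing constants: `δ(h z, h z') = τ δ(z, z')`
(`semimetric_eq_of_limitLoss_le`).

The rest is geometry. Inverting `j`, the distance of two images is a function of the distance of the
points. Therefore all derivatives of `h` in the interior multiply the norm by one constant `c`,
positive by injectivity. The mean value inequality for `h` and for its local inverse makes `h` a
local similarity that covers balls, and the Mazur-Ulam argument makes it affine near each point.
Connectedness gives one affine map on the interior (`exists_affineEquiv_of_norm_sub_eq`), and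
density extends the identity to `Z`. If `τ = 1`, then `h` preserves distances on a compact set and
is therefore onto (`surjOn_of_isometryOn_isCompact`). -/

/-! ### Openness of injective maps with invertible derivatives -/

/-- An injective map with invertible derivatives (not assumed continuous) is open. -/
theorem isOpen_image_of_hasFDerivAt_equiv {E : Type*} [NormedAddCommGroup E] [NormedSpace ℝ E] [FiniteDimensional ℝ E]
    {h : E → E} {U : Set E} (hU : IsOpen U)
    (hd : ∀ x ∈ U, ∃ L : E ≃L[ℝ] E, HasFDerivAt h (L : E →L[ℝ] E) x) (hi : InjOn h U) :
    IsOpen (h '' U) := by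
  have hc : ContinuousOn h U := fun x hx =>
    (hd x hx).choose_spec.continuousAt.continuousWithinAt
  rw [isOpen_iff_mem_nhds]
  rintro _ ⟨x₀, hx₀, rfl⟩
  obtain ⟨r, hr, hrU⟩ := Metric.nhds_basis_closedBall.mem_iff.1 (hU.mem_nhds hx₀)
  -- The norm of `E` need not be differentiable; the square of a Euclidean norm is.
  let Λ := toEuclidean (E := E)
  have hcb : ContinuousOn h (Metric.closedBall x₀ r) := hc.mono hrU
  obtain ⟨m, hm, hmS⟩ : ∃ m, 0 < m ∧ ∀ x ∈ Metric.sphere x₀ r, m ≤ ‖Λ (h x - h x₀)‖ := by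
    refine (isCompact_sphere x₀ r).exists_forall_le' (f := fun x => ‖Λ (h x - h x₀)‖) ?_ ?_
    · exact (Λ.continuous.comp_continuousOn
        ((hcb.mono Metric.sphere_subset_closedBall).sub continuousOn_const)).norm
    · intro x hx
      rw [norm_pos_iff]
      intro h0
      have h1 : h x = h x₀ := by simpa [sub_eq_zero] using h0
      have h2 := hi (hrU (Metric.sphere_subset_closedBall hx)) hx₀ h1
      rw [h2, mem_sphere_iff_norm] at hx
      simp at hx
      exact hr.ne hx
  -- With radius `m / 2`, the centre `x₀` does better than every point of the sphere, so the
  -- minimizer of the distance to `y` is interior.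
  have hN : {y | ‖Λ (y - h x₀)‖ < m / 2} ∈ 𝓝 (h x₀) := by
    refine IsOpen.mem_nhds (isOpen_lt (by fun_prop) continuous_const) ?_
    simpa using hm
  filter_upwards [hN] with y hy
  have hy : ‖Λ (y - h x₀)‖ < m / 2 := hy
  obtain ⟨x₁, hx₁, hmin⟩ := (isCompact_closedBall x₀ r).exists_isMinOn
    (f := fun x => ‖Λ (h x - y)‖ ^ 2) ⟨x₀, Metric.mem_closedBall_self hr.le⟩
    ((Λ.continuous.comp_continuousOn (hcb.sub continuousOn_const)).norm.pow 2)
  have hle : ‖Λ (h x₁ - y)‖ ≤ ‖Λ (h x₀ - y)‖ :=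
    le_of_sq_le_sq (hmin (Metric.mem_closedBall_self hr.le)) (norm_nonneg _)
  have hball : x₁ ∈ Metric.ball x₀ r := by
    rcases (Metric.mem_closedBall.1 hx₁).lt_or_eq with hlt | heq
    · exact hlt
    · exfalso
      have h1 := hmS x₁ heq
      have h2 : Λ (h x₁ - h x₀) = Λ (h x₁ - y) + Λ (y - h x₀) := by
        rw [← map_add]; congr 1; abel
      have h3 : ‖Λ (h x₀ - y)‖ = ‖Λ (y - h x₀)‖ := by
        rw [← norm_neg, ← map_neg, neg_sub]
      have h4 := norm_add_le (Λ (h x₁ - y)) (Λ (y - h x₀))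
      rw [← h2] at h4
      linarith
  obtain ⟨L, hL⟩ := hd x₁ (hrU hx₁)
  have hloc : IsLocalMin (fun x => ‖Λ (h x - y)‖ ^ 2) x₁ :=
    hmin.isLocalMin (Filter.mem_of_superset (Metric.isOpen_ball.mem_nhds hball)
      Metric.ball_subset_closedBall)
  have hder : HasFDerivAt (fun x => Λ (h x - y))
      ((Λ : E →L[ℝ] EuclideanSpace ℝ (Fin (Module.finrank ℝ E))).comp (L : E →L[ℝ] E)) x₁ :=
    Λ.hasFDerivAt.comp x₁ (hL.sub_const y)
  have hz := hloc.hasFDerivAt_eq_zero hder.norm_sq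
  -- In this direction the vanishing derivative equals `2 * ‖Λ (h x₁ - y)‖ ^ 2`.
  have hz' := congrArg (fun T => T (L.symm (h x₁ - y))) hz
  refine ⟨x₁, hrU hx₁, ?_⟩
  have : Λ (h x₁ - y) = 0 := by
    simpa [-map_sub] using hz'
  simpa [sub_eq_zero] using this

/-! ### Mazur-Ulam: midpoints described by distances alone -/

/-- The sets of approximate midpoints in the proof of the Mazur-Ulam theorem. -/
def midSet {F : Type*} [NormedAddCommGroup F] (x y : F) : ℕ → Set F
  | 0 => {u | ‖u - x‖ = ‖x - y‖ / 2 ∧ ‖u - y‖ = ‖x - y‖ / 2}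
  | n + 1 => {u | u ∈ midSet x y n ∧ ∀ v ∈ midSet x y n, ‖u - v‖ ≤ ‖x - y‖ / 2 ^ (n + 1)}

theorem midSet_subset_zero {E : Type*} [NormedAddCommGroup E]
    (x y : E) (n : ℕ) : midSet x y n ⊆ midSet x y 0 := by
  induction n with
  | zero => exact Subset.rfl
  | succ n ih => exact fun u hu => ih hu.1

theorem norm_sub_le_of_mem_midSet {E : Type*} [NormedAddCommGroup E]
    (x y : E) (n : ℕ) {u v : E} (hu : u ∈ midSet x y n)
    (hv : v ∈ midSet x y n) : ‖u - v‖ ≤ ‖x - y‖ / 2 ^ n := by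
  cases n with
  | zero =>
    have h1 : ‖u - v‖ ≤ ‖u - x‖ + ‖v - x‖ := by
      rw [← sub_sub_sub_cancel_right u v x]; exact norm_sub_le _ _
    rw [hu.1, hv.1] at h1
    simpa using h1
  | succ n => exact hu.2 v hv.1

theorem reflect_mem_midSet {E : Type*} [NormedAddCommGroup E]
    (x y : E) (n : ℕ) {u : E} (hu : u ∈ midSet x y n) :
    x + y - u ∈ midSet x y n := by
  induction n generalizing u with
  | zero =>
    constructor
    · rw [← hu.2, ← norm_neg (u - y)]; congr 1; abel
    · rw [← hu.1, ← norm_neg (u - x)]; congr 1; abel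
  | succ n ih =>
    refine ⟨ih hu.1, fun v hv => ?_⟩
    rw [← norm_neg, show -(x + y - u - v) = u - (x + y - v) by abel]
    exact hu.2 _ (ih hv)

/-- The reflection `v ↦ x + y - v` preserves each set and moves `v` by twice its distance to the
midpoint. So the midpoint is within half the diameter bound of every point of the set, as the next
stage demands. -/
theorem midpoint_mem_midSet {E : Type*} [NormedAddCommGroup E] [NormedSpace ℝ E]
    (x y : E) (n : ℕ) : midpoint ℝ x y ∈ midSet x y n := by
  induction n with
  | zero =>
    constructor
    · rw [← dist_eq_norm, dist_midpoint_left, dist_eq_norm]; norm_num; ring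
    · rw [← dist_eq_norm, dist_midpoint_right, dist_eq_norm]; norm_num; ring
  | succ n ih =>
    refine ⟨ih, fun v hv => ?_⟩
    have h1 := norm_sub_le_of_mem_midSet x y n (reflect_mem_midSet x y n hv) hv
    have h2 : x + y - v - v = (2 : ℝ) • (midpoint ℝ x y - v) := by
      rw [smul_sub, midpoint_eq_smul_add, smul_smul]; norm_num; rw [two_smul]; abel
    rw [h2, norm_smul] at h1
    norm_num at h1
    rw [pow_succ, ← div_div]
    linarith

theorem eq_midpoint_of_mem_midSet {E : Type*} [NormedAddCommGroup E] [NormedSpace ℝ E]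
    (x y : E) {u : E} (hu : ∀ n, u ∈ midSet x y n) :
    u = midpoint ℝ x y := by
  rw [← sub_eq_zero, ← norm_le_zero_iff]
  have : Tendsto (fun n : ℕ => ‖x - y‖ * (1 / 2) ^ n) atTop (𝓝 (‖x - y‖ * 0)) :=
    (tendsto_pow_atTop_nhds_zero_of_lt_one (by norm_num) (by norm_num)).const_mul _
  rw [mul_zero] at this
  refine ge_of_tendsto' this fun n => ?_
  have := norm_sub_le_of_mem_midSet x y n (hu n) (midpoint_mem_midSet x y n)
  simpa [div_eq_mul_inv] using this

/-- A local similarity that covers a ball preserves the approximate midpoints. -/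
theorem mem_midSet_iff_of_local_similarity {E : Type*} [NormedAddCommGroup E]
    {h : E → E} {x₀ : E} {c r : ℝ} (hc : 0 < c)
    (hiso : ∀ u ∈ Metric.ball x₀ r, ∀ v ∈ Metric.ball x₀ r, ‖h u - h v‖ = c * ‖u - v‖)
    (hsurj : ∀ w ∈ Metric.ball (h x₀) (c * r), ∃ u ∈ Metric.ball x₀ r, h u = w)
    {y : E} (hy : y ∈ Metric.ball x₀ r) (n : ℕ) {u : E} (hu : u ∈ Metric.ball x₀ r) :
    h u ∈ midSet (h x₀) (h y) n ↔ u ∈ midSet x₀ y n := by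
  have hr : 0 < r := Metric.pos_of_mem_ball hy
  have hx₀ := Metric.mem_ball_self (x := x₀) hr
  induction n generalizing u with
  | zero =>
    simp only [midSet, mem_ofPred_eq, hiso u hu x₀ hx₀, hiso u hu y hy, hiso x₀ hx₀ y hy,
      mul_div_assoc, mul_right_inj' hc.ne']
  | succ n ih =>
    have hyr : ‖x₀ - y‖ < r := by rwa [norm_sub_rev, ← mem_ball_iff_norm]
    simp only [midSet, mem_ofPred_eq, ih hu, hiso x₀ hx₀ y hy, mul_div_assoc]
    refine and_congr_right fun _ => ⟨fun H v hv => ?_, fun H w hw => ?_⟩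
    -- Metric midpoints lie at distance `‖x₀ - y‖ / 2 < r` from `x₀`, so the local hypothesis
    -- applies to every competitor.
    · have hvb : v ∈ Metric.ball x₀ r := by
        rw [mem_ball_iff_norm, (midSet_subset_zero _ _ n hv).1]
        linarith [norm_nonneg (x₀ - y)]
      have := H (h v) ((ih hvb).2 hv)
      rw [hiso u hu v hvb] at this
      exact le_of_mul_le_mul_left this hc
    -- Competitors in the target must be images of points of the ball; this is where covering is
    -- needed.
    · have hwb : w ∈ Metric.ball (h x₀) (c * r) := by
        rw [mem_ball_iff_norm, (midSet_subset_zero _ _ n hw).1, hiso x₀ hx₀ y hy]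
        nlinarith [norm_nonneg (x₀ - y)]
      obtain ⟨v, hv, rfl⟩ := hsurj w hwb
      rw [hiso u hu v hv]
      exact mul_le_mul_of_nonneg_left (H v ((ih hv).1 hw)) hc.le

theorem map_midpoint_of_local_similarity {E : Type*} [NormedAddCommGroup E] [NormedSpace ℝ E]
    {h : E → E} {x₀ : E} {c r : ℝ} (hc : 0 < c)
    (hiso : ∀ u ∈ Metric.ball x₀ r, ∀ v ∈ Metric.ball x₀ r, ‖h u - h v‖ = c * ‖u - v‖)
    (hsurj : ∀ w ∈ Metric.ball (h x₀) (c * r), ∃ u ∈ Metric.ball x₀ r, h u = w)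
    {y : E} (hy : y ∈ Metric.ball x₀ r) :
    h (midpoint ℝ x₀ y) = midpoint ℝ (h x₀) (h y) := by
  have hr : 0 < r := Metric.pos_of_mem_ball hy
  refine eq_midpoint_of_mem_midSet _ _ fun n => ?_
  refine (mem_midSet_iff_of_local_similarity hc hiso hsurj hy n ?_).2 (midpoint_mem_midSet _ _ n)
  exact (convex_ball x₀ r).midpoint_mem (Metric.mem_ball_self hr) hy

/-- A map which preserves the midpoints with `x₀` agrees near `x₀` with its derivative. -/
theorem eq_fderiv_of_map_midpoint {E : Type*} [NormedAddCommGroup E] [NormedSpace ℝ E]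
    {h : E → E} {x₀ : E} {r : ℝ} {L : E →L[ℝ] E}
    (hL : HasFDerivAt h L x₀)
    (hmid : ∀ y ∈ Metric.ball x₀ r, h (midpoint ℝ x₀ y) = midpoint ℝ (h x₀) (h y))
    {y : E} (hy : y ∈ Metric.ball x₀ r) : h y = h x₀ + L (y - x₀) := by
  have hr : 0 < r := Metric.pos_of_mem_ball hy
  have hstep : ∀ n : ℕ, x₀ + (1 / 2 : ℝ) ^ n • (y - x₀) ∈ Metric.ball x₀ r ∧
      h (x₀ + (1 / 2 : ℝ) ^ n • (y - x₀)) - h x₀ = (1 / 2 : ℝ) ^ n • (h y - h x₀) := by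
    intro n
    induction n with
    | zero => simpa using hy
    | succ n ih =>
      have he : x₀ + (1 / 2 : ℝ) ^ (n + 1) • (y - x₀) =
          midpoint ℝ x₀ (x₀ + (1 / 2 : ℝ) ^ n • (y - x₀)) := by
        rw [midpoint_eq_smul_add, invOf_eq_inv, pow_succ]
        module
      refine ⟨?_, ?_⟩
      · rw [he]
        exact (convex_ball x₀ r).midpoint_mem (Metric.mem_ball_self hr) ih.1
      · rw [he, hmid _ ih.1, midpoint_eq_smul_add, invOf_eq_inv, pow_succ', mul_smul, ← ih.2]
        module
  -- These difference quotients converge to the derivative, while `hstep` makes them constant.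
  have hlim : Tendsto (fun n : ℕ => ((2 : ℝ) ^ n) •
      (h (x₀ + (1 / 2 : ℝ) ^ n • (y - x₀)) - h x₀)) atTop (𝓝 (L (y - x₀))) := by
    have := hL.lim (y - x₀) (c := fun n : ℕ => (2 : ℝ) ^ n) (l := atTop) (by
      simpa using tendsto_pow_atTop_atTop_of_one_lt (one_lt_two (α := ℝ)))
    simpa only [one_div, inv_pow] using this
  have hconst : ∀ n : ℕ, ((2 : ℝ) ^ n) • (h (x₀ + (1 / 2 : ℝ) ^ n • (y - x₀)) - h x₀) =
      h y - h x₀ := by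
    intro n
    rw [(hstep n).2, smul_smul, ← mul_pow]
    norm_num
  simp only [hconst] at hlim
  have := tendsto_nhds_unique hlim tendsto_const_nhds
  rw [this]; abel

/-! ### From a distance law to an affine map -/

/-- The sequence involves neither the point `x` nor the unit vector `w`, so by uniqueness of limits
`‖L w‖` is the same for all of them. -/
theorem tendsto_scale_of_norm_sub_eq {E : Type*} [NormedAddCommGroup E] [NormedSpace ℝ E]
    {h : E → E} {U : Set E} (hU : IsOpen U) {φ : ℝ → ℝ}
    (hφ : ∀ x ∈ U, ∀ y ∈ U, ‖h x - h y‖ = φ ‖x - y‖) {x : E} (hx : x ∈ U) {L : E →L[ℝ] E}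
    (hL : HasFDerivAt h L x) {w : E} (hw : ‖w‖ = 1) :
    Tendsto (fun n : ℕ => (2 : ℝ) ^ n * φ ((2 : ℝ) ^ n)⁻¹) atTop (𝓝 ‖L w‖) := by
  have htop : Tendsto (fun n : ℕ => (2 : ℝ) ^ n) atTop atTop :=
    tendsto_pow_atTop_atTop_of_one_lt (one_lt_two (α := ℝ))
  have h1 := (hL.lim w (c := fun n : ℕ => (2 : ℝ) ^ n) (l := atTop) (by simpa using htop)).norm
  refine h1.congr' ?_
  have h2 : Tendsto (fun n : ℕ => x + ((2 : ℝ) ^ n)⁻¹ • w) atTop (𝓝 x) := by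
    simpa using tendsto_const_nhds.add (htop.inv_tendsto_atTop.smul_const w)
  filter_upwards [h2.eventually_mem (hU.mem_nhds hx)] with n hn
  rw [norm_smul, hφ _ hn _ hx]
  simp [norm_smul, hw]

/-- If the distance of two images is a function of the distance of the points, then all
derivatives are similarities with a common ratio. -/
theorem exists_scale_of_norm_sub_eq {E : Type*} [NormedAddCommGroup E] [NormedSpace ℝ E]
    [Nontrivial E] {h : E → E} {U : Set E} (hU : IsOpen U) (hUc : Convex ℝ U) (hUn : U.Nonempty)
    (hd : DifferentiableOn ℝ h U) (hi : InjOn h U) {φ : ℝ → ℝ}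
    (hφ : ∀ x ∈ U, ∀ y ∈ U, ‖h x - h y‖ = φ ‖x - y‖) :
    ∃ c : ℝ, 0 < c ∧ ∀ x ∈ U, ∀ w, ‖fderiv ℝ h x w‖ = c * ‖w‖ := by
  obtain ⟨x₀, hx₀⟩ := hUn
  obtain ⟨e, he⟩ := exists_norm_eq E (zero_le_one (α := ℝ))
  have hder : ∀ x ∈ U, HasFDerivAt h (fderiv ℝ h x) x := fun x hx =>
    (hd.differentiableAt (hU.mem_nhds hx)).hasFDerivAt
  have hc : ∀ x ∈ U, ∀ w, ‖fderiv ℝ h x w‖ = ‖fderiv ℝ h x₀ e‖ * ‖w‖ := by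
    intro x hx w
    rcases eq_or_ne w 0 with rfl | hw
    · simp
    have hw' : ‖w‖ ≠ 0 := norm_ne_zero_iff.2 hw
    have h1 : ‖(‖w‖⁻¹ • w)‖ = 1 := by
      rw [norm_smul, norm_inv, norm_norm, inv_mul_cancel₀ hw']
    have h2 := tendsto_nhds_unique (tendsto_scale_of_norm_sub_eq hU hφ hx (hder x hx) h1)
      (tendsto_scale_of_norm_sub_eq hU hφ hx₀ (hder x₀ hx₀) he)
    rw [← h2, map_smul, norm_smul, norm_inv, norm_norm]
    field_simp
  refine ⟨_, ?_, hc⟩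
  -- Ratio zero would make `h` constant on the convex set `U`, against injectivity.
  by_contra h0
  have h0 : ‖fderiv ℝ h x₀ e‖ = 0 := le_antisymm (not_lt.1 h0) (norm_nonneg _)
  have hz : ∀ x ∈ U, fderiv ℝ h x = 0 := by
    intro x hx
    ext w
    exact norm_eq_zero.1 (by rw [hc x hx, h0, zero_mul])
  obtain ⟨r, hr, hrU⟩ := Metric.isOpen_iff.1 hU x₀ hx₀
  have hmem : x₀ + (r / 2) • e ∈ U := by
    apply hrU
    rw [mem_ball_iff_norm, add_sub_cancel_left, norm_smul, he, Real.norm_of_nonneg (by positivity)]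
    linarith
  have := hi hmem hx₀ (hU.is_const_of_fderiv_eq_zero hUc.isPreconnected hd
    (fun x hx => hz x hx) hmem hx₀)
  have h3 : (r / 2) • e = 0 := by simpa using this
  have h4 : e ≠ 0 := by rintro rfl; simp at he
  rcases smul_eq_zero.1 h3 with h5 | h5
  · linarith
  · exact h4 h5

/-- An injective map all of whose derivatives are similarities of ratio `c` is, near each point,
a similarity of ratio `c` that covers a ball. -/
theorem exists_local_similarity {E : Type*} [NormedAddCommGroup E] [NormedSpace ℝ E]
    [FiniteDimensional ℝ E] {h : E → E} {U : Set E} (hU : IsOpen U) (hUc : Convex ℝ U)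
    (hd : DifferentiableOn ℝ h U) (hi : InjOn h U) {c : ℝ} (hc : 0 < c)
    (hs : ∀ x ∈ U, ∀ w, ‖fderiv ℝ h x w‖ = c * ‖w‖) {x₀ : E} (hx₀ : x₀ ∈ U) :
    ∃ r, 0 < r ∧ (∀ u ∈ Metric.ball x₀ r, ∀ v ∈ Metric.ball x₀ r, ‖h u - h v‖ = c * ‖u - v‖) ∧
      ∀ w ∈ Metric.ball (h x₀) (c * r), ∃ u ∈ Metric.ball x₀ r, h u = w := by
  have hder : ∀ x ∈ U, HasFDerivAt h (fderiv ℝ h x) x := fun x hx =>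
    (hd.differentiableAt (hU.mem_nhds hx)).hasFDerivAt
  have hequiv : ∀ x ∈ U, ∃ L : E ≃L[ℝ] E, HasFDerivAt h (L : E →L[ℝ] E) x := by
    intro x hx
    have hinj : Function.Injective (fderiv ℝ h x : E →ₗ[ℝ] E) := by
      rw [injective_iff_map_eq_zero]
      intro w hw
      have := hs x hx w
      rw [show fderiv ℝ h x w = 0 from hw, norm_zero, eq_comm, mul_eq_zero] at this
      exact norm_eq_zero.1 (this.resolve_left hc.ne')
    refine ⟨(LinearEquiv.ofInjectiveEndo _ hinj).toContinuousLinearEquiv, ?_⟩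
    convert hder x hx using 1
    ext w
    rfl
  have hopen : ∀ O ⊆ U, IsOpen O → IsOpen (h '' O) := fun O hO hO' =>
    isOpen_image_of_hasFDerivAt_equiv hO' (fun x hx => hequiv x (hO hx)) (hi.mono hO)
  have hle : ∀ u ∈ U, ∀ v ∈ U, ‖h u - h v‖ ≤ c * ‖u - v‖ := fun u hu v hv =>
    hUc.norm_image_sub_le_of_norm_fderiv_le (fun x hx => (hder x hx).differentiableAt)
      (fun x hx => ContinuousLinearMap.opNorm_le_bound _ hc.le fun w => (hs x hx w).le) hv hu
  let k := Function.invFunOn h U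
  have hkh : ∀ u ∈ U, k (h u) = u := fun u hu => hi.leftInvOn_invFunOn hu
  have hkU : ∀ w ∈ h '' U, k w ∈ U := fun w hw => Function.invFunOn_mem hw
  have hhk : ∀ w ∈ h '' U, h (k w) = w := fun w hw => Function.invFunOn_eq hw
  -- Openness of `h` is continuity of its inverse, which the derivative rule for inverses requires.
  have hkc : ∀ w ∈ h '' U, ContinuousAt k w := by
    intro w hw
    rw [ContinuousAt, tendsto_def]
    intro s hs'
    have h1 : IsOpen (interior s ∩ U) := isOpen_interior.inter hU
    refine mem_of_superset ((hopen _ inter_subset_right h1).mem_nhds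
      ⟨k w, ⟨mem_interior_iff_mem_nhds.2 hs', hkU w hw⟩, hhk w hw⟩) ?_
    rintro _ ⟨u, hu, rfl⟩
    rw [mem_preimage, hkh u hu.2]
    exact interior_subset hu.1
  have hkd : ∀ w ∈ h '' U, DifferentiableAt ℝ k w ∧ ‖fderiv ℝ k w‖ ≤ c⁻¹ := by
    intro w hw
    obtain ⟨L, hL⟩ := hequiv (k w) (hkU w hw)
    have hk : HasFDerivAt k (L.symm : E →L[ℝ] E) w := by
      refine HasFDerivAt.of_local_left_inverse (hkc w hw) hL ?_
      filter_upwards [(hopen U Subset.rfl hU).mem_nhds hw] with y hy using hhk y hy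
    refine ⟨hk.differentiableAt, ?_⟩
    rw [hk.fderiv]
    refine ContinuousLinearMap.opNorm_le_bound _ (by positivity) fun y => ?_
    have := hs (k w) (hkU w hw) (L.symm y)
    rw [hL.fderiv] at this
    simp only [ContinuousLinearEquiv.coe_coe, ContinuousLinearEquiv.apply_symm_apply] at this
    rw [this]
    simp [inv_mul_cancel_left₀ hc.ne']
  obtain ⟨ρ, hρ, hρU⟩ := Metric.isOpen_iff.1 (hopen U Subset.rfl hU) (h x₀) ⟨x₀, hx₀, rfl⟩
  obtain ⟨r₁, hr₁, hr₁U⟩ := Metric.isOpen_iff.1 hU x₀ hx₀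
  have hkle : ∀ u ∈ Metric.ball (h x₀) ρ, ∀ v ∈ Metric.ball (h x₀) ρ,
      ‖k u - k v‖ ≤ c⁻¹ * ‖u - v‖ := fun u hu v hv =>
    (convex_ball _ _).norm_image_sub_le_of_norm_fderiv_le (fun x hx => (hkd x (hρU hx)).1)
      (fun x hx => (hkd x (hρU hx)).2) hv hu
  -- The bound `r₁` keeps the ball in `U`; the bound `ρ / c` keeps its image, under the
  -- `c`-Lipschitz map `h`, in the ball where `k` is `c⁻¹`-Lipschitz. The two Lipschitz bounds
  -- together force equality.
  let r := min r₁ (ρ / c)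
  have hr : 0 < r := lt_min hr₁ (by positivity)
  have hrU : Metric.ball x₀ r ⊆ U := (Metric.ball_subset_ball (min_le_left _ _)).trans hr₁U
  have hcr : c * r ≤ ρ := by
    have := mul_le_mul_of_nonneg_left (min_le_right r₁ (ρ / c)) hc.le
    rwa [mul_div_cancel₀ _ hc.ne'] at this
  have hhb : ∀ u ∈ Metric.ball x₀ r, h u ∈ Metric.ball (h x₀) ρ := by
    intro u hu
    rw [mem_ball_iff_norm] at hu ⊢
    exact ((hle u (hrU (mem_ball_iff_norm.2 hu)) x₀ hx₀).trans_lt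
      (mul_lt_mul_of_pos_left hu hc)).trans_le hcr
  refine ⟨r, hr, fun u hu v hv => le_antisymm (hle u (hrU hu) v (hrU hv)) ?_, fun w hw => ?_⟩
  · have := hkle _ (hhb u hu) _ (hhb v hv)
    rw [hkh u (hrU hu), hkh v (hrU hv)] at this
    rwa [inv_mul_eq_div, le_div_iff₀' hc] at this
  · have hwρ := Metric.ball_subset_ball hcr hw
    refine ⟨k w, ?_, hhk w (hρU hwρ)⟩
    have := hkle w hwρ (h x₀) (Metric.mem_ball_self hρ)
    rw [hkh x₀ hx₀] at this
    rw [mem_ball_iff_norm] at hw ⊢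
    refine this.trans_lt ?_
    rwa [inv_mul_eq_div, div_lt_iff₀' hc]

/-- A local version of the Mazur-Ulam theorem for differentiable maps. -/
theorem exists_affineEquiv_of_norm_sub_eq {E : Type*} [NormedAddCommGroup E] [NormedSpace ℝ E]
    [FiniteDimensional ℝ E] {h : E → E} {U : Set E} (hU : IsOpen U) (hUc : Convex ℝ U)
    (hUn : U.Nonempty) (hd : DifferentiableOn ℝ h U) (hi : InjOn h U) {φ : ℝ → ℝ}
    (hφ : ∀ x ∈ U, ∀ y ∈ U, ‖h x - h y‖ = φ ‖x - y‖) :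
    ∃ A : E ≃ᵃ[ℝ] E, EqOn h A U := by
  rcases subsingleton_or_nontrivial E with hE | hE
  · exact ⟨AffineEquiv.refl ℝ E, fun x _ => Subsingleton.elim _ _⟩
  obtain ⟨c, hc, hs⟩ := exists_scale_of_norm_sub_eq hU hUc hUn hd hi hφ
  have hder : ∀ x ∈ U, HasFDerivAt h (fderiv ℝ h x) x := fun x hx =>
    (hd.differentiableAt (hU.mem_nhds hx)).hasFDerivAt
  have hconst : ∀ x ∈ U, fderiv ℝ h =ᶠ[𝓝 x] fun _ => fderiv ℝ h x := by
    intro x hx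
    obtain ⟨r, hr, hiso, hsurj⟩ := exists_local_similarity hU hUc hd hi hc hs hx
    filter_upwards [Metric.ball_mem_nhds x hr] with y hy
    have heq : h =ᶠ[𝓝 y] fun z => h x + fderiv ℝ h x (z - x) := by
      filter_upwards [Metric.isOpen_ball.mem_nhds hy] with z hz
      exact eq_fderiv_of_map_midpoint (hder x hx)
        (fun y hy => map_midpoint_of_local_similarity hc hiso hsurj hy) hz
    rw [heq.fderiv_eq]
    exact ((((fderiv ℝ h x).hasFDerivAt).comp y ((hasFDerivAt_id y).sub_const x)).const_add
      (h x)).fderiv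
  obtain ⟨x₀, hx₀⟩ := hUn
  -- A locally constant derivative is itself differentiable with derivative zero, hence constant on
  -- the connected set `U`.
  have hder2 : ∀ x ∈ U, HasFDerivAt (fderiv ℝ h) (0 : E →L[ℝ] E →L[ℝ] E) x := fun x hx =>
    (hasFDerivAt_const _ x).congr_of_eventuallyEq (hconst x hx)
  have hLeq : ∀ x ∈ U, fderiv ℝ h x = fderiv ℝ h x₀ := fun x hx =>
    hU.is_const_of_fderiv_eq_zero hUc.isPreconnected
      (fun y hy => (hder2 y hy).differentiableAt.differentiableWithinAt)
      (fun y hy => (hder2 y hy).fderiv) hx hx₀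
  have hinj : Function.Injective (fderiv ℝ h x₀ : E →ₗ[ℝ] E) := by
    rw [injective_iff_map_eq_zero]
    intro w hw
    have := hs x₀ hx₀ w
    rw [show fderiv ℝ h x₀ w = 0 from hw, norm_zero, eq_comm, mul_eq_zero] at this
    exact norm_eq_zero.1 (this.resolve_left hc.ne')
  let L : E ≃ₗ[ℝ] E := LinearEquiv.ofInjectiveEndo _ hinj
  have hLapp : ∀ w, L w = fderiv ℝ h x₀ w := fun w => rfl
  refine ⟨L.toAffineEquiv.trans (AffineEquiv.constVAdd ℝ E (h x₀ - L x₀)), fun x hx => ?_⟩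
  have hz : ∀ y ∈ U, HasFDerivAt (fun z => h z - fderiv ℝ h x₀ z) (0 : E →L[ℝ] E) y := by
    intro y hy
    have := (hder y hy).sub (fderiv ℝ h x₀).hasFDerivAt
    rwa [hLeq y hy, sub_self] at this
  have := hU.is_const_of_fderiv_eq_zero hUc.isPreconnected
    (fun y hy => (hz y hy).differentiableAt.differentiableWithinAt)
    (fun y hy => (hz y hy).fderiv) hx hx₀
  have h2 : h x = h x₀ - fderiv ℝ h x₀ x₀ + fderiv ℝ h x₀ x := by
    rw [← this]; abel
  rw [h2]
  simp [hLapp]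

/-! ### Distance-preserving self-maps, and passage to an arbitrary norm -/

/-- A self-map of a compact set that preserves distances is onto. -/
theorem surjOn_of_isometryOn_isCompact {F : Type*} [MetricSpace F] {h : F → F} {Z : Set F}
    (hZ : IsCompact Z) (hm : MapsTo h Z Z) (hd : ∀ x ∈ Z, ∀ y ∈ Z, dist (h x) (h y) = dist x y) :
    SurjOn h Z Z := by
  have hcont : ContinuousOn h Z := by
    refine LipschitzOnWith.continuousOn (K := 1) (LipschitzOnWith.of_dist_le_mul fun x hx y hy => ?_)
    simp [hd x hx y hy]
  intro y hy
  by_contra hyn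
  obtain ⟨ε, hε, hεZ⟩ := Metric.isOpen_iff.1 (hZ.image_of_continuousOn hcont).isClosed.isOpen_compl
    y hyn
  have hit : ∀ n, h^[n] y ∈ Z := fun n => hm.iterate n hy
  have hdist : ∀ n (u v : F), u ∈ Z → v ∈ Z → dist (h^[n] u) (h^[n] v) = dist u v := by
    intro n
    induction n with
    | zero => simp
    | succ n ih =>
      intro u v hu hv
      rw [Function.iterate_succ_apply, Function.iterate_succ_apply, ih _ _ (hm hu) (hm hv),
        hd u hu v hv]
  -- Cancelling `n` iterations compares the missed point `y` with `h^[k + 1] y`, which lies in the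
  -- image. The orbit is thus `ε`-separated and has no convergent subsequence.
  have hsep : ∀ n k, ε ≤ dist (h^[n] y) (h^[n + (k + 1)] y) := by
    intro n k
    rw [Function.iterate_add_apply, hdist n _ _ hy (hit _), Function.iterate_succ_apply']
    by_contra hlt
    refine hεZ (a := h (h^[k] y)) ?_ ⟨_, hit k, rfl⟩
    rw [Metric.mem_ball, dist_comm]
    exact not_le.1 hlt
  obtain ⟨a, -, s, hs, hlim⟩ := hZ.tendsto_subseq hit
  obtain ⟨n, hn⟩ := Metric.cauchySeq_iff.1 hlim.cauchySeq ε hε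
  have h1 := hn n le_rfl (n + 1) n.le_succ
  obtain ⟨k, hk⟩ := Nat.exists_eq_add_of_lt (hs n.lt_succ_self)
  have h2 := hsep (s n) k
  rw [← add_assoc, ← hk] at h2
  exact absurd h1 (not_lt.2 h2)

universe u

/-- A positive definite seminorm is the norm of a normed space. -/
theorem exists_normedSpace_of_seminorm {E : Type u} [AddCommGroup E] [Module ℝ E]
    (p : Seminorm ℝ E) (hp : ∀ x, p x = 0 → x = 0) :
    ∃ (F : Type u) (_ : NormedAddCommGroup F) (_ : NormedSpace ℝ F) (e : E ≃ₗ[ℝ] F),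
      ∀ x, ‖e x‖ = p x := by
  -- The witness is `E` itself; the existential statement keeps its new norm apart from any norm `E`
  -- already carries.
  let _ : Norm E := ⟨p⟩
  have core : NormedSpace.Core ℝ E :=
    { norm_nonneg := fun x => apply_nonneg p x
      norm_smul := fun c x => map_smul_eq_mul p c x
      norm_triangle := fun x y => map_add_le_add p x y
      norm_eq_zero_iff := fun x => ⟨hp x, fun h => by rw [h]; exact map_zero p⟩ }
  let _ : NormedAddCommGroup E := NormedAddCommGroup.ofCore core
  exact ⟨E, NormedAddCommGroup.ofCore core, NormedSpace.ofCore core, LinearEquiv.refl ℝ E,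
    fun x => rfl⟩

/-- A positive definite seminorm on a finite-dimensional space bounds the norm. -/
theorem exists_norm_le_seminorm {E : Type*} [NormedAddCommGroup E] [NormedSpace ℝ E]
    [FiniteDimensional ℝ E] (p : Seminorm ℝ E) (hp : ∀ x, p x = 0 → x = 0) :
    ∃ C : ℝ, 0 < C ∧ (∀ x, ‖x‖ ≤ C * p x) ∧ ∀ x, p x ≤ C * ‖x‖ := by
  obtain ⟨F, _, _, e, he⟩ := exists_normedSpace_of_seminorm p hp
  have := e.finiteDimensional
  let Λ := e.toContinuousLinearEquiv
  obtain ⟨a, ha, hae⟩ := (Λ : E →L[ℝ] F).isBoundedLinearMap.bound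
  obtain ⟨b, hb, hbe⟩ := (Λ.symm : F →L[ℝ] E).isBoundedLinearMap.bound
  refine ⟨max a b, lt_max_of_lt_left ha, fun x => ?_, fun x => ?_⟩
  · have := hbe (Λ x)
    simp only [ContinuousLinearEquiv.coe_coe, ContinuousLinearEquiv.symm_apply_apply] at this
    refine this.trans ?_
    rw [show ‖Λ x‖ = p x from he x]
    exact mul_le_mul_of_nonneg_right (le_max_right _ _) (apply_nonneg p x)
  · rw [← he x]
    exact (hae x).trans (mul_le_mul_of_nonneg_right (le_max_left _ _) (norm_nonneg _))

/-- Conjugation by the linear equivalence to the space normed by `p` reduces this to the normed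
case; in finite dimension the equivalence is bicontinuous, so differentiability and openness
survive. -/
theorem exists_affineEquiv_of_seminorm_sub_eq {E : Type*} [NormedAddCommGroup E]
    [NormedSpace ℝ E] [FiniteDimensional ℝ E] (p : Seminorm ℝ E) (hp : ∀ x, p x = 0 → x = 0)
    {h : E → E} {U : Set E} (hU : IsOpen U) (hUc : Convex ℝ U)
    (hUn : U.Nonempty) (hd : DifferentiableOn ℝ h U) (hi : InjOn h U) {φ : ℝ → ℝ}
    (hφ : ∀ x ∈ U, ∀ y ∈ U, p (h x - h y) = φ (p (x - y))) :
    ∃ A : E ≃ᵃ[ℝ] E, EqOn h A U := by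
  obtain ⟨F, _, _, e, he⟩ := exists_normedSpace_of_seminorm p hp
  have := e.finiteDimensional
  let Λ := e.toContinuousLinearEquiv
  obtain ⟨A, hA⟩ := exists_affineEquiv_of_norm_sub_eq (h := Λ ∘ h ∘ Λ.symm) (U := Λ.symm ⁻¹' U)
    (φ := φ) (hU.preimage Λ.symm.continuous) (hUc.linear_preimage (Λ.symm : F →ₗ[ℝ] E))
    (hUn.preimage Λ.symm.surjective)
    (Λ.differentiable.comp_differentiableOn
      (hd.comp Λ.symm.differentiable.differentiableOn (fun x hx => hx)))
    (fun x hx y hy hxy => Λ.symm.injective (hi hx hy (Λ.injective hxy)))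
    (fun x hx y hy => by
      have h1 : ‖x - y‖ = p (Λ.symm x - Λ.symm y) := by
        rw [← he, ← map_sub]
        exact congrArg norm (Λ.apply_symm_apply (x - y)).symm
      have h2 : ‖Λ (h (Λ.symm x)) - Λ (h (Λ.symm y))‖ = p (h (Λ.symm x) - h (Λ.symm y)) := by
        rw [← map_sub]; exact he _
      rw [h1, ← hφ _ hx _ hy, ← h2]
      rfl)
  refine ⟨e.toAffineEquiv.trans (A.trans e.symm.toAffineEquiv), fun x hx => ?_⟩
  have := hA (x := Λ x) (by simpa using hx)
  have h3 : A (e x) = e (h x) := by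
    rw [show A (e x) = A (Λ x) from rfl, ← this]
    simp only [Function.comp_apply, ContinuousLinearEquiv.symm_apply_apply]
    rfl
  simp [h3]

/-- Turns a deviation of sample averages into a deviation of losses. -/
theorem abs_log_sub_log_le {a x y : ℝ} (ha : 0 < a) (hx : a ≤ x) (hy : a ≤ y) :
    |Real.log x - Real.log y| ≤ |x - y| / a := by
  have key : ∀ x y : ℝ, a ≤ x → a ≤ y → Real.log x - Real.log y ≤ |x - y| / a := by
    intro x y hx hy
    have hx0 := ha.trans_le hx
    have hy0 := ha.trans_le hy
    rw [← Real.log_div hx0.ne' hy0.ne']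
    calc Real.log (x / y) ≤ x / y - 1 := Real.log_le_sub_one_of_pos (by positivity)
      _ = (x - y) / y := by field_simp
      _ ≤ |x - y| / y := by gcongr; exact le_abs_self _
      _ ≤ |x - y| / a := by gcongr
  refine abs_le.2 ⟨?_, key x y hx hy⟩
  have := key y x hy hx
  rw [abs_sub_comm] at this
  linarith

/-! ### The limit of the loss as the number of negatives grows -/

section Probability

variable {Ω : Type*} [MeasurableSpace Ω]

theorem integrable_of_measurable_of_abs_le {μ : Measure Ω} [IsFiniteMeasure μ] {f : Ω → ℝ}
    (hf : Measurable f) {C : ℝ} (hC : ∀ x, |f x| ≤ C) : Integrable f μ :=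
  Integrable.of_bound hf.aestronglyMeasurable C (ae_of_all _ hC)

/-- The mean absolute deviation of a sample average from the mean. -/
theorem integral_abs_average_sub_le (μ : Measure Ω) [IsProbabilityMeasure μ] {Y : Ω → ℝ}
    (hY : Measurable Y) (h0 : ∀ x, 0 ≤ Y x) (h1 : ∀ x, Y x ≤ 1) {M : ℕ} (hM : 0 < M) :
    ∫ s : Fin M → Ω, |(∑ i, Y (s i)) / M - ∫ u, Y u ∂μ| ∂(Measure.pi fun _ => μ) ≤
      1 / √M := by
  have hM' : (0 : ℝ) < M := Nat.cast_pos.2 hM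
  have hsq : 0 < √(M : ℝ) := Real.sqrt_pos.2 hM'
  set m := ∫ u, Y u ∂μ with hm
  have hYL : MemLp Y 2 μ := MemLp.of_bound hY.aestronglyMeasurable 1
    (ae_of_all _ fun x => by rw [Real.norm_of_nonneg (h0 x)]; exact h1 x)
  have hYi : Integrable Y μ := hYL.integrable one_le_two
  have hvarY : ProbabilityTheory.variance Y μ ≤ 1 := by
    refine (ProbabilityTheory.variance_le_expectation_sq hY.aestronglyMeasurable).trans ?_
    calc ∫ x, (Y ^ 2) x ∂μ ≤ ∫ _, (1 : ℝ) ∂μ :=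
          integral_mono hYL.integrable_sq (integrable_const 1)
            fun x => pow_le_one₀ (h0 x) (h1 x)
      _ = 1 := by simp
  have hev : ∀ i : Fin M, Integrable (fun s : Fin M → Ω => Y (s i)) (Measure.pi fun _ => μ) :=
    fun i => (measurePreserving_eval (fun _ : Fin M => μ) i).integrable_comp_of_integrable hYi
  have hmean : ∫ s : Fin M → Ω, ∑ i, Y (s i) ∂(Measure.pi fun _ => μ) = M * m := by
    rw [integral_finsetSum _ fun i _ => hev i]
    have : ∀ i : Fin M, ∫ s : Fin M → Ω, Y (s i) ∂(Measure.pi fun _ => μ) = m := fun i =>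
      integral_comp_eval (μ := fun _ : Fin M => μ) hY.aestronglyMeasurable
    simp [this]
  have hmeas : Measurable fun s : Fin M → Ω => ∑ i, Y (s i) :=
    Finset.measurable_fun_sum _ fun i _ => hY.comp (measurable_pi_apply i)
  have hvar : ∫ s : Fin M → Ω, (∑ i, Y (s i) - M * m) ^ 2 ∂(Measure.pi fun _ => μ) ≤ M := by
    have h2 := ProbabilityTheory.variance_sum_pi (μ := fun _ : Fin M => μ) (X := fun _ => Y)
      fun _ => hYL
    have h3 : (∑ i : Fin M, fun ω : Fin M → Ω => Y (ω i)) = fun s => ∑ i, Y (s i) := by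
      ext s; simp
    rw [h3, ProbabilityTheory.variance_eq_integral hmeas.aemeasurable, hmean] at h2
    rw [h2]
    calc ∑ _i : Fin M, ProbabilityTheory.variance Y μ ≤ ∑ _i : Fin M, (1 : ℝ) :=
          Finset.sum_le_sum fun _ _ => hvarY
      _ = M := by simp
  have hbd : ∀ s : Fin M → Ω, |∑ i, Y (s i) - M * m| ≤ M + |M * m| := by
    intro s
    refine (abs_sub _ _).trans (add_le_add_left ?_ _)
    rw [abs_of_nonneg (Finset.sum_nonneg fun i _ => h0 _)]
    simpa using Finset.sum_le_sum fun (i : Fin M) (_ : i ∈ Finset.univ) => h1 (s i)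
  have hint2 : Integrable (fun s : Fin M → Ω => (∑ i, Y (s i) - M * m) ^ 2)
      (Measure.pi fun _ => μ) := by
    refine integrable_of_measurable_of_abs_le ((hmeas.sub_const _).pow_const 2)
      (C := (M + |M * m|) ^ 2) fun s => ?_
    rw [abs_pow]
    exact pow_le_pow_left₀ (abs_nonneg _) (hbd s) 2
  -- Young's inequality for `|T| / M`, with weights that balance when the mean of `T ^ 2` is `M`; it
  -- replaces Cauchy-Schwarz.
  have hpt : ∀ s : Fin M → Ω, |(∑ i, Y (s i)) / M - m| ≤
      (∑ i, Y (s i) - M * m) ^ 2 * (1 / (2 * (M * √M))) + 1 / (2 * √M) := by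
    intro s
    set T := ∑ i, Y (s i) - M * m with hT
    have h4 : (∑ i, Y (s i)) / M - m = T / M := by rw [hT]; field_simp
    rw [h4, abs_div, abs_of_pos hM']
    have h5 : T ^ 2 * (1 / (2 * (M * √M))) + 1 / (2 * √M) - |T| / M =
        (|T| - √M) ^ 2 / (2 * (M * √M)) := by
      have h6 : √(M : ℝ) ^ 2 = M := Real.sq_sqrt hM'.le
      rw [← sq_abs T]
      field_simp
      ring_nf
      rw [h6]
    have h7 : 0 ≤ (|T| - √M) ^ 2 / (2 * (M * √M)) := by positivity
    linarith
  calc _ ≤ ∫ s : Fin M → Ω, ((∑ i, Y (s i) - M * m) ^ 2 * (1 / (2 * (M * √M))) + 1 / (2 * √M))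
        ∂(Measure.pi fun _ => μ) :=
        integral_mono_of_nonneg (ae_of_all _ fun _ => abs_nonneg _)
          ((hint2.mul_const _).add (integrable_const _)) (ae_of_all _ hpt)
    _ = (∫ s : Fin M → Ω, (∑ i, Y (s i) - M * m) ^ 2 ∂(Measure.pi fun _ => μ)) *
          (1 / (2 * (M * √M))) + 1 / (2 * √M) := by
        rw [integral_add (hint2.mul_const _) (integrable_const _), integral_mul_const]
        simp
    _ ≤ M * (1 / (2 * (M * √M))) + 1 / (2 * √M) := by gcongr
    _ = 1 / √M := by field_simp; norm_num

/-- The limit of the contrastive loss, up to `log M`, for similarities `E`. -/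
noncomputable def limitLoss (μ : Measure Ω) (ν : Measure (Ω × Ω)) (E : Ω × Ω → ℝ) : ℝ :=
  ∫ w, (-Real.log (E w) + Real.log (∫ u, E (u, w.2) ∂μ)) ∂ν

theorem measurable_integral_left (μ : Measure Ω) [SFinite μ] {E : Ω × Ω → ℝ} (hE : Measurable E) :
    Measurable fun y => ∫ u, E (u, y) ∂μ := by
  exact (hE.stronglyMeasurable.integral_prod_left' (μ := μ)).measurable

theorem integral_mem_Icc_of_forall (μ : Measure Ω) [IsProbabilityMeasure μ] {Y : Ω → ℝ}
    (hY : Measurable Y) {a b : ℝ} (ha : 0 < a) (h : ∀ x, Y x ∈ Icc a b) :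
    ∫ x, Y x ∂μ ∈ Icc a b := by
  have hi : Integrable Y μ := integrable_of_measurable_of_abs_le hY (C := b) fun x => by
    rw [abs_of_pos (ha.trans_le (h x).1)]; exact (h x).2
  constructor
  · simpa using integral_mono (μ := μ) (integrable_const a) hi fun x => (h x).1
  · simpa using integral_mono (μ := μ) hi (integrable_const b) fun x => (h x).2

theorem abs_log_le_of_mem_Icc {a x : ℝ} (ha : 0 < a) (hx : x ∈ Icc a 1) :
    |Real.log x| ≤ -Real.log a := by
  rw [abs_of_nonpos (Real.log_nonpos (ha.le.trans hx.1) hx.2)]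
  exact neg_le_neg (Real.log_le_log ha hx.1)

theorem abs_limitLoss_integrand_le (μ : Measure Ω) [IsProbabilityMeasure μ]
    {E : Ω × Ω → ℝ} (hE : Measurable E) {a : ℝ} (ha : 0 < a) (h : ∀ w, E w ∈ Icc a 1)
    (w : Ω × Ω) :
    |-Real.log (E w) + Real.log (∫ u, E (u, w.2) ∂μ)| ≤ 2 * -Real.log a := by
  refine (abs_add_le _ _).trans ?_
  rw [abs_neg]
  have h1 := abs_log_le_of_mem_Icc ha (h w)
  have h2 := abs_log_le_of_mem_Icc ha (integral_mem_Icc_of_forall μ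
    (Y := fun u => E (u, w.2)) (hE.comp (measurable_id.prodMk measurable_const)) ha
    fun x => h (x, w.2))
  linarith

theorem measurable_limitLoss_integrand (μ : Measure Ω) [SFinite μ] {E : Ω × Ω → ℝ}
    (hE : Measurable E) :
    Measurable fun w : Ω × Ω => -Real.log (E w) + Real.log (∫ u, E (u, w.2) ∂μ) :=
  hE.log.neg.add ((measurable_integral_left μ hE).comp measurable_snd).log

/-- The two integrands differ by `log ((E + S) / M) - log C`, where `S` sums over the negatives and
`C` is the mean similarity. Both arguments are at least `a`, so the logarithm is `1 / a`-Lipschitz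
there. The positive term contributes at most `1 / M`, the sampling error `1 / √M`. -/
theorem abs_loss_sub_limitLoss_le (μ : Measure Ω) [IsProbabilityMeasure μ] (ν : Measure (Ω × Ω))
    [IsProbabilityMeasure ν] {E : Ω × Ω → ℝ} (hE : Measurable E) {a : ℝ} (ha : 0 < a)
    (h : ∀ w, E w ∈ Icc a 1) {M : ℕ} (hM : 0 < M) :
    |(∫ s : (Ω × Ω) × (Fin M → Ω), -Real.log (E s.1 / (E s.1 + ∑ i, E (s.2 i, s.1.2)))
      ∂(ν.prod (Measure.pi fun _ => μ))) - Real.log M - limitLoss μ ν E| ≤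
      (1 / M + 1 / √M) / a := by
  have hM' : (0 : ℝ) < M := Nat.cast_pos.2 hM
  let C : Ω → ℝ := fun y => ∫ u, E (u, y) ∂μ
  have hCm : Measurable C := measurable_integral_left μ hE
  have hEy : ∀ y, Measurable fun u => E (u, y) := fun y =>
    hE.comp (measurable_id.prodMk measurable_const)
  have hC : ∀ y, C y ∈ Icc a 1 := fun y =>
    integral_mem_Icc_of_forall μ (hEy y) ha fun x => h (x, y)
  have hEpos : ∀ w, 0 < E w := fun w => ha.trans_le (h w).1
  let S : (Ω × Ω) × (Fin M → Ω) → ℝ := fun s => ∑ i, E (s.2 i, s.1.2)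
  have hSm : Measurable S := Finset.measurable_fun_sum _ fun i _ => hE.comp
    (((measurable_pi_apply i).comp measurable_snd).prodMk (measurable_snd.comp measurable_fst))
  have hSlow : ∀ s, M * a ≤ S s := fun s => by
    simpa using Finset.sum_le_sum fun (i : Fin M) (_ : i ∈ Finset.univ) =>
      (h (s.2 i, s.1.2)).1
  have hSup : ∀ s, S s ≤ M := fun s => by
    simpa using Finset.sum_le_sum fun (i : Fin M) (_ : i ∈ Finset.univ) =>
      (h (s.2 i, s.1.2)).2
  have hS0 : ∀ s, 0 ≤ S s := fun s => (mul_pos hM' ha).le.trans (hSlow s)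
  have hE1 : Measurable fun s : (Ω × Ω) × (Fin M → Ω) => E s.1 := hE.comp measurable_fst
  have hlossm : Measurable fun s : (Ω × Ω) × (Fin M → Ω) =>
      -Real.log (E s.1 / (E s.1 + S s)) := (hE1.div (hE1.add hSm)).log.neg
  have hlossi : Integrable (fun s : (Ω × Ω) × (Fin M → Ω) =>
      -Real.log (E s.1 / (E s.1 + S s))) (ν.prod (Measure.pi fun _ => μ)) := by
    refine integrable_of_measurable_of_abs_le hlossm (C := -Real.log (a / (1 + M))) fun s => ?_
    have hden : 0 < E s.1 + S s := add_pos_of_pos_of_nonneg (hEpos _) (hS0 s)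
    rw [abs_neg]
    refine abs_log_le_of_mem_Icc (by positivity) ⟨?_, ?_⟩
    · exact div_le_div₀ (hEpos _).le (h _).1 hden (add_le_add (h _).2 (hSup s))
    · rw [div_le_one hden]; linarith [hS0 s]
  have hlimi := integrable_of_measurable_of_abs_le (μ := ν) (measurable_limitLoss_integrand μ hE)
    (abs_limitLoss_integrand_le μ hE ha h)
  have hlim : limitLoss μ ν E = ∫ s : (Ω × Ω) × (Fin M → Ω),
      (-Real.log (E s.1) + Real.log (C s.1.2)) ∂(ν.prod (Measure.pi fun _ => μ)) := by
    rw [integral_fun_fst (fun w : Ω × Ω => -Real.log (E w) + Real.log (C w.2))]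
    simp [limitLoss, C]
  have hlimi' : Integrable (fun s : (Ω × Ω) × (Fin M → Ω) =>
      -Real.log (E s.1) + Real.log (C s.1.2)) (ν.prod (Measure.pi fun _ => μ)) :=
    hlimi.comp_fst _
  have hlogM : Real.log M = ∫ _s : (Ω × Ω) × (Fin M → Ω), Real.log M
      ∂(ν.prod (Measure.pi fun _ => μ)) := by simp
  have hsub := integral_sub (hlossi.sub (integrable_const (Real.log M))) hlimi'
  simp only [Pi.sub_apply] at hsub
  rw [hlim, hlogM, ← integral_sub hlossi (integrable_const _), ← hsub, ← Real.norm_eq_abs]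
  have hpt : ∀ s, ‖-Real.log (E s.1 / (E s.1 + S s)) - Real.log M -
      (-Real.log (E s.1) + Real.log (C s.1.2))‖ ≤ (1 / M + |S s / M - C s.1.2|) / a := by
    intro s
    have hden : 0 < E s.1 + S s := add_pos_of_pos_of_nonneg (hEpos _) (hS0 s)
    have h1 : -Real.log (E s.1 / (E s.1 + S s)) - Real.log M -
      (-Real.log (E s.1) + Real.log (C s.1.2)) =
        Real.log ((E s.1 + S s) / M) - Real.log (C s.1.2) := by
      rw [Real.log_div (hEpos _).ne' hden.ne', Real.log_div hden.ne' hM'.ne']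
      ring
    rw [h1, Real.norm_eq_abs]
    refine (abs_log_sub_log_le ha ?_ (hC _).1).trans ?_
    · rw [le_div_iff₀ hM']
      linarith [hSlow s, hEpos s.1]
    · refine div_le_div_of_nonneg_right ?_ ha.le
      have h2 : (E s.1 + S s) / M - C s.1.2 = E s.1 / M + (S s / M - C s.1.2) := by ring
      rw [h2]
      refine (abs_add_le _ _).trans (add_le_add_left ?_ _)
      rw [abs_of_pos (div_pos (hEpos _) hM')]
      exact div_le_div_of_nonneg_right (h _).2 hM'.le
  have hdevm : Measurable fun s => |S s / M - C s.1.2| :=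
    ((hSm.div_const _).sub (hCm.comp (measurable_snd.comp measurable_fst))).abs
  have hdevi : Integrable (fun s => |S s / M - C s.1.2|) (ν.prod (Measure.pi fun _ => μ)) := by
    refine integrable_of_measurable_of_abs_le hdevm (C := 1) fun s => ?_
    rw [abs_abs, abs_le]
    have h3 : S s / M ≤ 1 := (div_le_one hM').2 (hSup s)
    have h4 : 0 ≤ S s / M := div_nonneg (hS0 s) hM'.le
    have h5 := hC s.1.2
    constructor <;> linarith [h5.1, h5.2]
  have hdev : ∫ s, |S s / M - C s.1.2| ∂(ν.prod (Measure.pi fun _ => μ)) ≤ 1 / √M := by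
    rw [integral_prod _ hdevi]
    calc _ ≤ ∫ _w, 1 / √(M : ℝ) ∂ν := by
          refine integral_mono_of_nonneg
            (ae_of_all _ fun w => integral_nonneg fun _ => abs_nonneg _) (integrable_const _)
            (ae_of_all _ fun w => ?_)
          exact integral_abs_average_sub_le μ (hEy w.2) (fun x => (hEpos _).le)
            (fun x => (h _).2) hM
      _ = 1 / √M := by simp
  refine (norm_integral_le_of_norm_le
    (((integrable_const (1 / (M : ℝ))).add hdevi).div_const a) (ae_of_all _ hpt)).trans ?_
  simp only [Pi.add_apply]
  rw [integral_div, integral_add (integrable_const _) hdevi]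
  refine div_le_div_of_nonneg_right ?_ ha.le
  simpa using hdev

/-- The contrastive loss minus `log M` converges to the limit loss. -/
theorem tendsto_loss_sub_log (μ : Measure Ω) [IsProbabilityMeasure μ] (ν : Measure (Ω × Ω))
    [IsProbabilityMeasure ν] {E : Ω × Ω → ℝ} (hE : Measurable E) {a : ℝ} (ha : 0 < a)
    (h : ∀ w, E w ∈ Icc a 1) :
    Tendsto (fun M : ℕ => (∫ s : (Ω × Ω) × (Fin M → Ω),
      -Real.log (E s.1 / (E s.1 + ∑ i, E (s.2 i, s.1.2)))
      ∂(ν.prod (Measure.pi fun _ => μ))) - Real.log M) atTop (𝓝 (limitLoss μ ν E)) := by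
  rw [tendsto_iff_norm_sub_tendsto_zero]
  have hlim : Tendsto (fun M : ℕ => (1 / (M : ℝ) + 1 / √(M : ℝ)) / a) atTop (𝓝 ((0 + 0) / a)) := by
    refine Tendsto.div_const (Tendsto.add tendsto_one_div_atTop_nhds_zero_nat ?_) a
    simp only [one_div]
    exact (Real.tendsto_sqrt_atTop.comp tendsto_natCast_atTop_atTop).inv_tendsto_atTop
  rw [add_zero, zero_div] at hlim
  refine squeeze_zero' (Eventually.of_forall fun _ => norm_nonneg _) ?_ hlim
  filter_upwards [eventually_gt_atTop 0] with M hM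
  exact abs_loss_sub_limitLoss_le μ ν hE ha h hM

/-- The limit loss is continuous under pointwise convergence. -/
theorem tendsto_limitLoss (μ : Measure Ω) [IsProbabilityMeasure μ] (ν : Measure (Ω × Ω))
    [IsProbabilityMeasure ν] {E : ℕ → Ω × Ω → ℝ} {E' : Ω × Ω → ℝ} (hE : ∀ n, Measurable (E n))
    {a : ℝ} (ha : 0 < a) (h : ∀ n w, E n w ∈ Icc a 1) (hE' : ∀ w, E' w ∈ Icc a 1)
    (hlim : ∀ w, Tendsto (fun n => E n w) atTop (𝓝 (E' w))) :
    Tendsto (fun n => limitLoss μ ν (E n)) atTop (𝓝 (limitLoss μ ν E')) := by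
  have hEm' : Measurable E' := measurable_of_tendsto_metrizable hE (tendsto_pi_nhds.2 hlim)
  have hEy : ∀ n y, Measurable fun u => E n (u, y) := fun n y =>
    (hE n).comp (measurable_id.prodMk measurable_const)
  refine tendsto_integral_of_dominated_convergence (fun _ => 2 * -Real.log a)
    (fun n => (measurable_limitLoss_integrand μ (hE n)).aestronglyMeasurable)
    (integrable_const _)
    (fun n => ae_of_all _ (abs_limitLoss_integrand_le μ (hE n) ha (h n)))
    (ae_of_all _ fun w => ?_)
  have hC : Tendsto (fun n => ∫ u, E n (u, w.2) ∂μ) atTop (𝓝 (∫ u, E' (u, w.2) ∂μ)) := by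
    refine tendsto_integral_of_dominated_convergence (fun _ => 1)
      (fun n => (hEy n _).aestronglyMeasurable) (integrable_const _)
      (fun n => ae_of_all _ fun u => ?_) (ae_of_all _ fun u => hlim _)
    rw [Real.norm_of_nonneg (ha.le.trans (h n _).1)]
    exact (h n _).2
  have hC' := integral_mem_Icc_of_forall μ (Y := fun u => E' (u, w.2))
    (hEm'.comp (measurable_id.prodMk measurable_const)) ha fun x => hE' _
  exact ((hlim w).log (ha.trans_le (hE' w).1).ne').neg.add
    (hC.log (ha.trans_le hC'.1).ne')

/-! ### Cross-entropy and Gibbs' inequality -/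

/-- The conditional density proportional to the similarity `E` in the first variable. -/
noncomputable def simDensity (μ : Measure Ω) (E : Ω × Ω → ℝ) (w : Ω × Ω) : ℝ :=
  (∫ u, E (u, w.2) ∂μ)⁻¹ * E w

theorem measurable_simDensity (μ : Measure Ω) [SFinite μ] {E : Ω × Ω → ℝ} (hE : Measurable E) :
    Measurable (simDensity μ E) :=
  ((measurable_integral_left μ hE).comp measurable_snd).inv.mul hE

theorem integral_left_mem_Icc (μ : Measure Ω) [IsProbabilityMeasure μ] {E : Ω × Ω → ℝ}
    (hE : Measurable E) {a : ℝ} (ha : 0 < a) (h : ∀ w, E w ∈ Icc a 1)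
    (y : Ω) : ∫ u, E (u, y) ∂μ ∈ Icc a 1 :=
  integral_mem_Icc_of_forall μ (Y := fun u => E (u, y))
    (hE.comp (measurable_id.prodMk measurable_const)) ha fun x => h (x, y)

theorem integral_left_pos (μ : Measure Ω) [IsProbabilityMeasure μ] {E : Ω × Ω → ℝ}
    (hE : Measurable E) {a : ℝ} (ha : 0 < a) (h : ∀ w, E w ∈ Icc a 1)
    (y : Ω) : 0 < ∫ u, E (u, y) ∂μ :=
  ha.trans_le (integral_left_mem_Icc μ hE ha h y).1

theorem simDensity_pos (μ : Measure Ω) [IsProbabilityMeasure μ] {E : Ω × Ω → ℝ}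
    (hE : Measurable E) {a : ℝ} (ha : 0 < a) (h : ∀ w, E w ∈ Icc a 1)
    (w : Ω × Ω) : 0 < simDensity μ E w :=
  mul_pos (inv_pos.2 (integral_left_pos μ hE ha h _)) (ha.trans_le (h w).1)

theorem abs_simDensity_le (μ : Measure Ω) [IsProbabilityMeasure μ] {E : Ω × Ω → ℝ}
    (hE : Measurable E) {a : ℝ} (ha : 0 < a) (h : ∀ w, E w ∈ Icc a 1)
    (w : Ω × Ω) : |simDensity μ E w| ≤ a⁻¹ := by
  rw [abs_of_pos (simDensity_pos μ hE ha h w)]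
  calc _ ≤ a⁻¹ * 1 := mul_le_mul (inv_anti₀ ha (integral_left_mem_Icc μ hE ha h _).1) (h w).2
        (ha.trans_le (h w).1).le (inv_pos.2 ha).le
    _ = a⁻¹ := mul_one _

/-- Identifies the integrand of `limitLoss` as that of a cross-entropy. -/
theorem neg_log_simDensity (μ : Measure Ω) [IsProbabilityMeasure μ] {E : Ω × Ω → ℝ}
    (hE : Measurable E) {a : ℝ} (ha : 0 < a) (h : ∀ w, E w ∈ Icc a 1)
    (w : Ω × Ω) :
    -Real.log (simDensity μ E w) = -Real.log (E w) + Real.log (∫ u, E (u, w.2) ∂μ) := by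
  rw [simDensity, Real.log_mul (inv_pos.2 (integral_left_pos μ hE ha h _)).ne'
    (ha.trans_le (h w).1).ne', Real.log_inv]
  ring

theorem integrable_simDensity (μ : Measure Ω) [IsProbabilityMeasure μ] {E : Ω × Ω → ℝ}
    (hE : Measurable E) {a : ℝ} (ha : 0 < a) (h : ∀ w, E w ∈ Icc a 1) :
    Integrable (simDensity μ E) (μ.prod μ) :=
  integrable_of_measurable_of_abs_le (measurable_simDensity μ hE) (abs_simDensity_le μ hE ha h)

theorem integral_simDensity (μ : Measure Ω) [IsProbabilityMeasure μ] {E : Ω × Ω → ℝ}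
    (hE : Measurable E) {a : ℝ} (ha : 0 < a) (h : ∀ w, E w ∈ Icc a 1) :
    ∫ w, simDensity μ E w ∂(μ.prod μ) = 1 := by
  rw [integral_prod_symm _ (integrable_simDensity μ hE ha h)]
  have : ∀ y, ∫ x, simDensity μ E (x, y) ∂μ = 1 := fun y => by
    simp only [simDensity]
    rw [integral_const_mul, inv_mul_cancel₀ (integral_left_pos μ hE ha h y).ne']
  simp [this]

theorem isProbabilityMeasure_withDensity_simDensity (μ : Measure Ω) [IsProbabilityMeasure μ] {E : Ω × Ω → ℝ}
    (hE : Measurable E) {a : ℝ} (ha : 0 < a) (h : ∀ w, E w ∈ Icc a 1) :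
    IsProbabilityMeasure
    ((μ.prod μ).withDensity fun w => ENNReal.ofReal (simDensity μ E w)) := by
  constructor
  rw [withDensity_apply _ MeasurableSet.univ, Measure.restrict_univ,
    ← ofReal_integral_eq_lintegral_ofReal (integrable_simDensity μ hE ha h)
      (ae_of_all _ fun w => (simDensity_pos μ hE ha h w).le), integral_simDensity μ hE ha h,
    ENNReal.ofReal_one]

theorem limitLoss_withDensity (μ : Measure Ω) [SFinite μ] (E : Ω × Ω → ℝ)
    {p : Ω × Ω → ℝ} (hp : Measurable p) (hp0 : ∀ w, 0 < p w) :
    limitLoss μ ((μ.prod μ).withDensity fun w => ENNReal.ofReal (p w)) E =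
      ∫ w, p w * (-Real.log (E w) + Real.log (∫ u, E (u, w.2) ∂μ)) ∂(μ.prod μ) := by
  rw [limitLoss, integral_withDensity_eq_integral_toReal_smul
    hp.ennreal_ofReal (ae_of_all _ fun _ => ENNReal.ofReal_lt_top)]
  refine integral_congr_ae (ae_of_all _ fun w => ?_)
  simp only [ENNReal.toReal_ofReal (hp0 w).le, smul_eq_mul]

/-- Gibbs' inequality, with its equality case. -/
theorem ae_eq_of_integral_mul_log_le {μ : Measure Ω} {p q : Ω → ℝ} (hp0 : ∀ w, 0 < p w)
    (hq0 : ∀ w, 0 < q w) (hp : Integrable p μ) (hq : Integrable q μ)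
    (hint : ∫ w, q w ∂μ = ∫ w, p w ∂μ)
    (hpq : Integrable (fun w => p w * -Real.log (q w)) μ)
    (hpp : Integrable (fun w => p w * -Real.log (p w)) μ)
    (hle : ∫ w, p w * -Real.log (q w) ∂μ ≤ ∫ w, p w * -Real.log (p w) ∂μ) : q =ᵐ[μ] p := by
  -- The added term `q - p` has integral zero and makes the integrand pointwise nonnegative: it is
  -- `p * (t - 1 - log t)` with `t = q / p`.
  let D : Ω → ℝ := fun w => (p w * -Real.log (q w) - p w * -Real.log (p w)) + (q w - p w)
  have hDe : ∀ w, D w = p w * (q w / p w - 1 - Real.log (q w / p w)) := by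
    intro w
    simp only [D]
    rw [Real.log_div (hq0 w).ne' (hp0 w).ne']
    have := (hp0 w).ne'
    field_simp
    ring
  have hD0 : ∀ w, 0 ≤ D w := fun w => by
    rw [hDe]
    have := Real.log_le_sub_one_of_pos (div_pos (hq0 w) (hp0 w))
    exact mul_nonneg (hp0 w).le (by linarith)
  have hDi : Integrable D μ := (hpq.sub hpp).add (hq.sub hp)
  have hDint : ∫ w, D w ∂μ ≤ 0 := by
    have h1 := integral_add (hpq.sub hpp) (hq.sub hp)
    have h2 := integral_sub hpq hpp
    have h3 := integral_sub hq hp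
    simp only [Pi.sub_apply] at h1
    simp only [D]
    rw [h1, h2, h3]
    linarith
  have hDz := (integral_eq_zero_iff_of_nonneg hD0 hDi).1
    (le_antisymm hDint (integral_nonneg hD0))
  filter_upwards [hDz] with w hw
  have hw : D w = 0 := hw
  by_contra hne
  have hne' : q w / p w ≠ 1 := fun h1 => hne ((div_eq_one_iff_eq (hp0 w).ne').1 h1)
  have hlt := Real.log_lt_sub_one_of_pos (div_pos (hq0 w) (hp0 w)) hne'
  rw [hDe] at hw
  exact (mul_pos (hp0 w) (sub_pos.2 hlt)).ne' hw

/-- The limit loss is minimal only where the conditional densities agree. -/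
theorem simDensity_ae_eq_of_limitLoss_le (μ : Measure Ω) [IsProbabilityMeasure μ]
    {E E₀ : Ω × Ω → ℝ} (hE : Measurable E) (hE₀ : Measurable E₀) {a : ℝ} (ha : 0 < a)
    (h : ∀ w, E w ∈ Icc a 1) (h₀ : ∀ w, E₀ w ∈ Icc a 1)
    (hle : limitLoss μ ((μ.prod μ).withDensity fun w => ENNReal.ofReal (simDensity μ E₀ w)) E ≤
      limitLoss μ ((μ.prod μ).withDensity fun w => ENNReal.ofReal (simDensity μ E₀ w)) E₀) :
    simDensity μ E =ᵐ[μ.prod μ] simDensity μ E₀ := by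
  have hpm := measurable_simDensity μ hE₀
  have hp0 := simDensity_pos μ hE₀ ha h₀
  have hint : ∀ {F : Ω × Ω → ℝ} (hF : Measurable F) (hF1 : ∀ w, F w ∈ Icc a 1), Integrable
      (fun w => simDensity μ E₀ w * -Real.log (simDensity μ F w)) (μ.prod μ) := by
    intro F hF hF1
    refine integrable_of_measurable_of_abs_le (C := a⁻¹ * (2 * -Real.log a))
      (hpm.mul (measurable_simDensity μ hF).log.neg) fun w => ?_
    rw [abs_mul, neg_log_simDensity μ hF ha hF1]
    exact mul_le_mul (abs_simDensity_le μ hE₀ ha h₀ w)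
      (abs_limitLoss_integrand_le μ hF ha hF1 w) (abs_nonneg _) (inv_pos.2 ha).le
  rw [limitLoss_withDensity μ E hpm hp0, limitLoss_withDensity μ E₀ hpm hp0] at hle
  refine ae_eq_of_integral_mul_log_le hp0 (simDensity_pos μ hE ha h)
    (integrable_simDensity μ hE₀ ha h₀) (integrable_simDensity μ hE ha h)
    (by rw [integral_simDensity μ hE ha h, integral_simDensity μ hE₀ ha h₀])
    (hint hE h) (hint hE₀ h₀) ?_
  simpa only [neg_log_simDensity μ hE ha h, neg_log_simDensity μ hE₀ ha h₀] using hle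

end Probability

/-! ### The semi-metric and its similarities -/

section Semimetric

variable {N : ℕ} {nrm : Seminorm ℝ (Rn N)} {j : ℝ≥0 ≃ₜ ℝ≥0}

theorem continuous_of_definite (hnrm : ∀ x, nrm x = 0 → x = 0) : Continuous nrm := by
  obtain ⟨C, -, -, hC⟩ := exists_norm_le_seminorm nrm hnrm
  refine (LipschitzWith.of_dist_le_mul (K := C.toNNReal) fun x y => ?_).continuous
  rw [Real.dist_eq, dist_eq_norm]
  refine (abs_sub_map_le_sub nrm x y).trans ((hC _).trans ?_)
  exact mul_le_mul_of_nonneg_right (Real.le_coe_toNNReal C) (norm_nonneg _)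

theorem continuous_semimetric (hnrm : ∀ x, nrm x = 0 → x = 0) :
    Continuous fun w : Rn N × Rn N => semimetric nrm j w.1 w.2 :=
  NNReal.continuous_coe.comp (j.continuous.comp
    (((continuous_of_definite hnrm).comp (continuous_fst.sub continuous_snd)).subtype_mk _))

theorem semimetric_nonneg (x y : Rn N) : 0 ≤ semimetric nrm j x y := NNReal.coe_nonneg _

theorem semimetric_self (hj : j 0 = 0) (x : Rn N) : semimetric nrm j x x = 0 := by
  have : (⟨nrm (x - x), apply_nonneg nrm (x - x)⟩ : ℝ≥0) = 0 := by
    ext; simp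
  exact (congrArg (fun t => (j t : ℝ)) this).trans (NNReal.coe_eq_zero.2 hj)

/-- The dependence of the norm on a multiple of the semi-metric. -/
noncomputable def rescale (j : ℝ≥0 ≃ₜ ℝ≥0) (τ : ℝ) (t : ℝ) : ℝ :=
  j.symm (Real.toNNReal (τ * j t.toNNReal))

theorem continuous_rescale (j : ℝ≥0 ≃ₜ ℝ≥0) (τ : ℝ) : Continuous (rescale j τ) :=
  NNReal.continuous_coe.comp (j.symm.continuous.comp (continuous_real_toNNReal.comp
    (continuous_const.mul (NNReal.continuous_coe.comp
      (j.continuous.comp continuous_real_toNNReal)))))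

theorem rescale_zero (hj : j 0 = 0) (τ : ℝ) : rescale j τ 0 = 0 := by
  simp [rescale, hj, j.symm_apply_eq]

theorem rescale_one {t : ℝ} (ht : 0 ≤ t) : rescale j 1 t = t := by
  simp [rescale, ht]

/-- Solving for the norm by `j.symm` yields the distance law that the geometric part takes as
hypothesis. -/
theorem norm_eq_rescale {τ : ℝ} {x y x' y' : Rn N}
    (h : semimetric nrm j x' y' = τ * semimetric nrm j x y) :
    nrm (x' - y') = rescale j τ (nrm (x - y)) := by
  have h1 : (nrm (x - y)).toNNReal = ⟨nrm (x - y), apply_nonneg nrm (x - y)⟩ :=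
    Real.toNNReal_of_nonneg _
  have h2 : τ * (j ⟨nrm (x - y), apply_nonneg nrm (x - y)⟩ : ℝ) =
      (j ⟨nrm (x' - y'), apply_nonneg nrm (x' - y')⟩ : ℝ) := h.symm
  rw [rescale, h1, h2, Real.toNNReal_coe]
  exact (congrArg NNReal.toReal (j.symm_apply_apply ⟨nrm (x' - y'), apply_nonneg _ _⟩)).symm

theorem eq_of_semimetric_eq_zero (hnrm : ∀ x, nrm x = 0 → x = 0) (hj : j 0 = 0) {x y : Rn N}
    (h : semimetric nrm j x y = 0) : x = y := by
  have h1 := j.injective ((NNReal.coe_eq_zero.1 h).trans hj.symm)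
  exact sub_eq_zero.1 (hnrm _ (congrArg NNReal.toReal h1))

/-- Needed for the matching map `h₀`, whose continuity is not assumed: `rescale j τ` is continuous
and vanishes at `0`. -/
theorem continuousOn_of_norm_eq_rescale (hnrm : ∀ x, nrm x = 0 → x = 0) (hj : j 0 = 0) {τ : ℝ}
    {h : Rn N → Rn N} {Z : Set (Rn N)}
    (hh : ∀ x ∈ Z, ∀ y ∈ Z, nrm (h x - h y) = rescale j τ (nrm (x - y))) : ContinuousOn h Z := by
  obtain ⟨C, hC, hC1, -⟩ := exists_norm_le_seminorm nrm hnrm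
  intro x hx
  rw [ContinuousWithinAt, tendsto_iff_norm_sub_tendsto_zero]
  have hlim : Tendsto (fun y => C * rescale j τ (nrm (y - x))) (𝓝[Z] x) (𝓝 0) := by
    have hc : Continuous fun y => C * rescale j τ (nrm (y - x)) :=
      continuous_const.mul ((continuous_rescale j τ).comp
        ((continuous_of_definite hnrm).comp (continuous_id.sub continuous_const)))
    have := hc.tendsto x
    simp only [sub_self, map_zero, rescale_zero hj, mul_zero] at this
    exact this.mono_left nhdsWithin_le_nhds
  refine squeeze_zero' (Eventually.of_forall fun _ => norm_nonneg _) ?_ hlim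
  filter_upwards [self_mem_nhdsWithin] with y hy
  rw [← hh y hy x hx]
  exact hC1 _

theorem surjOn_of_seminorm_sub_eq (hnrm : ∀ x, nrm x = 0 → x = 0) {h : Rn N → Rn N}
    {Z : Set (Rn N)} (hZ : IsCompact Z) (hm : MapsTo h Z Z)
    (hd : ∀ x ∈ Z, ∀ y ∈ Z, nrm (h x - h y) = nrm (x - y)) : SurjOn h Z Z := by
  obtain ⟨F, _, _, e, he⟩ := exists_normedSpace_of_seminorm nrm hnrm
  have := e.finiteDimensional
  have hZ' : IsCompact (e '' Z) := hZ.image e.toContinuousLinearEquiv.continuous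
  have key := surjOn_of_isometryOn_isCompact (h := e ∘ h ∘ e.symm) hZ'
    (by
      rintro _ ⟨x, hx, rfl⟩
      exact ⟨h x, hm hx, by simp⟩)
    (by
      rintro _ ⟨x, hx, rfl⟩ _ ⟨y, hy, rfl⟩
      simp only [Function.comp_apply, LinearEquiv.symm_apply_apply, dist_eq_norm]
      rw [← map_sub, ← map_sub, he, he, hd x hx y hy])
  intro y hy
  obtain ⟨_, ⟨x, hx, rfl⟩, hxy⟩ := key ⟨y, hy, rfl⟩
  refine ⟨x, hx, e.injective ?_⟩
  simpa using hxy

/-- The similarity `exp (-δ / τ)` of the images under `H`. -/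
noncomputable def similarity {α : Type*} (nrm : Seminorm ℝ (Rn N)) (j : ℝ≥0 ≃ₜ ℝ≥0) (τ : ℝ)
    (H : α → Rn N) (w : α × α) : ℝ :=
  Real.exp (-semimetric nrm j (H w.1) (H w.2) / τ)

theorem measurable_similarity {α : Type*} [MeasurableSpace α] (hnrm : ∀ x, nrm x = 0 → x = 0)
    (τ : ℝ) {H : α → Rn N} (hH : Measurable H) : Measurable (similarity nrm j τ H) :=
  (((continuous_semimetric hnrm).measurable.comp
    ((hH.comp measurable_fst).prodMk (hH.comp measurable_snd))).neg.div_const τ).exp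

theorem continuousOn_similarity {α : Type*} [TopologicalSpace α]
    (hnrm : ∀ x, nrm x = 0 → x = 0) (τ : ℝ) {H : α → Rn N} {Z : Set α} (hH : ContinuousOn H Z) :
    ContinuousOn (similarity nrm j τ H) (Z ×ˢ Z) :=
  Real.continuous_exp.comp_continuousOn ((((continuous_semimetric hnrm).comp_continuousOn
    ((hH.comp continuousOn_fst fun _ h => h.1).prodMk
      (hH.comp continuousOn_snd fun _ h => h.2))).neg).div_const τ)

theorem similarity_diag {α : Type*} (hj : j 0 = 0) (τ : ℝ) (H : α → Rn N) (x : α) :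
    similarity nrm j τ H (x, x) = 1 := by
  simp [similarity, semimetric_self hj]

/-- The semi-metric is bounded on `Z ×ˢ Z`, so one `a` serves all maps into `Z`. This uniformity
provides the dominating functions for a sequence of encoders. -/
theorem exists_similarity_mem_Icc (hnrm : ∀ x, nrm x = 0 → x = 0) {τ : ℝ} (hτ : 0 < τ)
    {Z : Set (Rn N)} (hZ : IsCompact Z) : ∃ a, 0 < a ∧ ∀ {α : Type} (H : α → Rn N),
      (∀ x, H x ∈ Z) → ∀ w, similarity nrm j τ H w ∈ Icc a 1 := by
  obtain ⟨B, hB⟩ := (hZ.prod hZ).bddAbove_image (continuous_semimetric (j := j) hnrm).continuousOn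
  refine ⟨Real.exp (-B / τ), Real.exp_pos _, fun H hH w => ⟨?_, ?_⟩⟩
  · refine Real.exp_le_exp.2 (div_le_div_of_nonneg_right (neg_le_neg ?_) hτ.le)
    exact hB ⟨(H w.1, H w.2), ⟨hH _, hH _⟩, rfl⟩
  · rw [similarity, Real.exp_le_one_iff, neg_div]
    exact neg_nonpos.2 (div_nonneg (semimetric_nonneg _ _) hτ.le)

end Semimetric

/-! ### From observations to latents -/

/-- The limit loss of a push-forward. -/
theorem limitLoss_map {Ω Ω' : Type*} [MeasurableSpace Ω] [MeasurableSpace Ω'] (μ : Measure Ω)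
    [SFinite μ] (ν : Measure (Ω × Ω)) {G : Ω → Ω'} (hG : Measurable G)
    {E : Ω' × Ω' → ℝ} (hE : Measurable E) :
    limitLoss (μ.map G) (ν.map (Prod.map G G)) E = limitLoss μ ν (E ∘ Prod.map G G) := by
  rw [limitLoss, limitLoss, integral_map (hG.prodMap hG).aemeasurable
    (measurable_limitLoss_integrand _ hE).aestronglyMeasurable]
  refine integral_congr_ae (ae_of_all _ fun w => ?_)
  simp only [Function.comp_apply, Prod.map_apply, Prod.map_snd]
  rw [integral_map (f := fun u => E (u, G w.2)) hG.aemeasurable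
    (hE.comp (measurable_id.prodMk measurable_const)).aestronglyMeasurable]

section Latent

variable {N K : ℕ} {Z : Set (Rn N)}

open Classical in
/-- A measurable extension of `f` from `S`, by a constant. -/
noncomputable def extendConst {α β : Type*} (S : Set α) (b : β) (f : α → β) : α → β :=
  S.piecewise f fun _ => b

theorem extendConst_of_mem {α β : Type*} {S : Set α} {b : β} {f : α → β} {x : α} (hx : x ∈ S) :
    extendConst S b f x = f x := by
  classical
  exact piecewise_eq_of_mem _ _ _ hx

theorem extendConst_mem {α β : Type*} {S : Set α} {T : Set β} {b : β} (hb : b ∈ T) {f : α → β}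
    (hf : MapsTo f S T) (x : α) : extendConst S b f x ∈ T := by
  classical
  by_cases hx : x ∈ S
  · rw [extendConst_of_mem hx]; exact hf hx
  · rwa [extendConst, piecewise_eq_of_notMem _ _ _ hx]

theorem measurable_extendConst {α β : Type*} [TopologicalSpace α] [MeasurableSpace α]
    [OpensMeasurableSpace α] [TopologicalSpace β] [MeasurableSpace β] [BorelSpace β] {S : Set α}
    (hS : MeasurableSet S) (b : β) {f : α → β} (hf : ContinuousOn f S) :
    Measurable (extendConst S b f) := by
  classical
  exact hf.measurable_piecewise continuousOn_const hS

theorem continuousOn_extendConst {α β : Type*} [TopologicalSpace α] [TopologicalSpace β]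
    {S : Set α} (b : β) {f : α → β} (hf : ContinuousOn f S) :
    ContinuousOn (extendConst S b f) S :=
  hf.congr fun _ hx => extendConst_of_mem hx

theorem isProbabilityMeasure_uniform (hZ : IsCompact Z) (hv : volume Z ≠ 0) :
    IsProbabilityMeasure (uniform Z) :=
  ProbabilityTheory.cond_isProbabilityMeasure_of_finite hv hZ.measure_lt_top.ne

theorem restrict_eq_smul_uniform (hZ : IsCompact Z) (hv : volume Z ≠ 0) :
    volume.restrict Z = volume Z • uniform Z := by
  rw [uniform, ProbabilityTheory.cond, smul_smul, ENNReal.mul_inv_cancel hv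
    hZ.measure_lt_top.ne, one_smul]

theorem ae_mem_uniform (hZ : IsCompact Z) : ∀ᵐ x ∂(uniform Z), x ∈ Z :=
  ProbabilityTheory.ae_cond_mem hZ.measurableSet

theorem setIntegral_eq_mul_integral_uniform (hZ : IsCompact Z) (hv : volume Z ≠ 0)
    (φ : Rn N → ℝ) : ∫ x in Z, φ x = volume.real Z * ∫ x, φ x ∂(uniform Z) := by
  rw [restrict_eq_smul_uniform hZ hv, integral_smul_measure]
  rfl

/-- The true conditional is the model conditional of the identity with `τ = 1`. Replacing Lebesgue
measure by the uniform law changes the reference measure and the normalizing constant by the same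
factor `volume Z`, which cancels. -/
theorem latentPair_eq_withDensity {nrm : Seminorm ℝ (Rn N)} {j : ℝ≥0 ≃ₜ ℝ≥0} (hZ : IsCompact Z)
    (hv : volume Z ≠ 0) (b : Rn N) :
    latentPair Z (semimetric nrm j) = ((uniform Z).prod (uniform Z)).withDensity fun w =>
      ENNReal.ofReal (simDensity (uniform Z) (similarity nrm j 1 (extendConst Z b id)) w) := by
  have := isProbabilityMeasure_uniform hZ hv
  have hfin : volume Z ≠ ⊤ := hZ.measure_lt_top.ne
  have hV : 0 < volume.real Z := ENNReal.toReal_pos hv hfin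
  rw [latentPair, restrict_eq_smul_uniform hZ hv, Measure.prod_smul_left,
    withDensity_smul_measure, ← withDensity_smul' _ _ hfin]
  refine withDensity_congr_ae ?_
  have h1 : ∀ᵐ w ∂((uniform Z).prod (uniform Z)), w.1 ∈ Z :=
    Measure.quasiMeasurePreserving_fst.ae (ae_mem_uniform hZ)
  have h2 : ∀ᵐ w ∂((uniform Z).prod (uniform Z)), w.2 ∈ Z :=
    Measure.quasiMeasurePreserving_snd.ae (ae_mem_uniform hZ)
  filter_upwards [h1, h2] with w hw1 hw2
  have h3 : ∫ u, similarity nrm j 1 (extendConst Z b id) (u, w.2) ∂(uniform Z) =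
      ∫ u, Real.exp (-semimetric nrm j u w.2) ∂(uniform Z) := by
    refine integral_congr_ae ?_
    filter_upwards [ae_mem_uniform hZ] with u hu
    simp [similarity, extendConst_of_mem hu, extendConst_of_mem hw2]
  rw [Pi.smul_apply, smul_eq_mul, trueDensity, setIntegral_eq_mul_integral_uniform hZ hv,
    simDensity, h3, ← ENNReal.ofReal_toReal hfin, ← ENNReal.ofReal_mul ENNReal.toReal_nonneg]
  congr 1
  simp only [similarity, extendConst_of_mem hw1, extendConst_of_mem hw2, id, div_one]
  rw [← Measure.real_def, mul_inv, ← mul_assoc, ← mul_assoc, mul_inv_cancel₀ hV.ne', one_mul]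

theorem continuousOn_simDensity (hZ : IsCompact Z) (hv : volume Z ≠ 0)
    {E : Rn N × Rn N → ℝ} (hE : Measurable E) (hEc : ContinuousOn E (Z ×ˢ Z)) {a : ℝ}
    (ha : 0 < a) (h : ∀ w, E w ∈ Icc a 1) :
    ContinuousOn (simDensity (uniform Z) E) (Z ×ˢ Z) := by
  have := isProbabilityMeasure_uniform hZ hv
  refine ContinuousOn.mul (ContinuousOn.inv₀ ?_ ?_) hEc
  · have : ContinuousOn (fun y => ∫ u, E (u, y) ∂(uniform Z)) Z := by
      refine continuousOn_of_dominated (bound := fun _ => 1)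
        (fun y _ => (hE.comp (measurable_id.prodMk measurable_const)).aestronglyMeasurable)
        (fun y _ => ae_of_all _ fun u => ?_) (integrable_const _) ?_
      · rw [Real.norm_of_nonneg (ha.le.trans (h _).1)]
        exact (h _).2
      · filter_upwards [ae_mem_uniform hZ] with u hu
        exact hEc.comp (continuousOn_const.prodMk continuousOn_id) fun y hy => ⟨hu, hy⟩
    exact this.comp continuousOn_snd fun w hw => hw.2
  · exact fun w _ => (integral_left_pos _ hE ha h _).ne'

/-- Almost everywhere equal continuous functions agree on the interior, where nonempty open sets
have positive measure, and then on its closure. -/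
theorem eqOn_of_ae_eq_uniform (hZ : IsCompact Z) (hv : volume Z ≠ 0)
    (hcl : Z ⊆ closure (interior Z)) {p q : Rn N × Rn N → ℝ}
    (hp : ContinuousOn p (Z ×ˢ Z)) (hq : ContinuousOn q (Z ×ˢ Z))
    (h : p =ᵐ[(uniform Z).prod (uniform Z)] q) : EqOn p q (Z ×ˢ Z) := by
  have := isProbabilityMeasure_uniform hZ hv
  have hac : volume.restrict Z ≪ uniform Z := by
    rw [restrict_eq_smul_uniform hZ hv]
    exact Measure.AbsolutelyContinuous.rfl.smul_left _
  have h1 : p =ᵐ[(volume.prod volume).restrict (Z ×ˢ Z)] q := by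
    rw [← Measure.prod_restrict]
    exact (hac.prod hac).ae_eq h
  refine Measure.eqOn_of_ae_eq h1 hp hq ?_
  rw [interior_prod_eq, closure_prod_eq]
  exact prod_mono hcl hcl

theorem tendsto_contrastiveLoss {nrm : Seminorm ℝ (Rn N)} (hnrm : ∀ x, nrm x = 0 → x = 0)
    {j : ℝ≥0 ≃ₜ ℝ≥0} (hZ : IsCompact Z) (hv : volume Z ≠ 0) {b : Rn N} (hb : b ∈ Z)
    {g : Rn N → Rn K} (hg : ContinuousOn g Z) {τ : ℝ} (hτ : 0 < τ) {f : Rn K → Rn N}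
    (hf : ContinuousOn f (g '' Z)) (hfZ : MapsTo f (g '' Z) Z) :
    Tendsto (fun M : ℕ => contrastiveLoss Z (semimetric nrm j) g τ f M - Real.log M) atTop
      (𝓝 (limitLoss (uniform Z) (latentPair Z (semimetric nrm j))
        (similarity nrm j τ (extendConst Z b (f ∘ g))))) := by
  have := isProbabilityMeasure_uniform hZ hv
  have hgZ : MeasurableSet (g '' Z) := (hZ.image_of_continuousOn hg).measurableSet
  -- Since `g` and `f` are controlled only on `Z` and `g '' Z`, they are replaced by measurable
  -- extensions that agree with them almost everywhere.
  let G : Rn N → Rn K := extendConst Z (g b) g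
  have hG : Measurable G := measurable_extendConst hZ.measurableSet _ hg
  have hGmem : ∀ x, G x ∈ g '' Z := extendConst_mem (mem_image_of_mem g hb) (mapsTo_image g Z)
  let F : Rn K → Rn N := extendConst (g '' Z) b f
  have hF : Measurable F := measurable_extendConst hgZ _ hf
  have hFmem : ∀ x, F x ∈ Z := extendConst_mem hb hfZ
  obtain ⟨a, ha, haE⟩ := exists_similarity_mem_Icc (j := j) hnrm hτ hZ
  obtain ⟨a₀, ha₀, haE₀⟩ := exists_similarity_mem_Icc (j := j) hnrm one_pos hZ
  have hr : Measurable (extendConst Z b (id : Rn N → Rn N)) :=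
    measurable_extendConst hZ.measurableSet _ continuousOn_id
  have hP : IsProbabilityMeasure (latentPair Z (semimetric nrm j)) := by
    rw [latentPair_eq_withDensity hZ hv b]
    exact isProbabilityMeasure_withDensity_simDensity _ (measurable_similarity hnrm 1 hr) ha₀
      (haE₀ _ (extendConst_mem hb (mapsTo_id Z)))
  have hPac : latentPair Z (semimetric nrm j) ≪ (uniform Z).prod (uniform Z) := by
    rw [latentPair_eq_withDensity hZ hv b]
    exact withDensity_absolutelyContinuous _ _
  have hgG : g =ᵐ[uniform Z] G := by
    filter_upwards [ae_mem_uniform hZ] with x hx using (extendConst_of_mem hx).symm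
  have hdata : pData Z g = (uniform Z).map G := Measure.map_congr hgG
  have hpos : pPos Z (semimetric nrm j) g =
      (latentPair Z (semimetric nrm j)).map (Prod.map G G) := by
    refine Measure.map_congr (hPac.ae_eq ?_)
    filter_upwards [Measure.quasiMeasurePreserving_fst.ae hgG,
      Measure.quasiMeasurePreserving_snd.ae hgG] with w h1 h2
    exact Prod.ext h1 h2
  have hdataP : IsProbabilityMeasure (pData Z g) := by
    rw [hdata]; exact Measure.isProbabilityMeasure_map hG.aemeasurable
  have hposP : IsProbabilityMeasure (pPos Z (semimetric nrm j) g) := by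
    rw [hpos]; exact Measure.isProbabilityMeasure_map (hG.prodMap hG).aemeasurable
  have hdata_mem : ∀ᵐ x ∂(pData Z g), x ∈ g '' Z := by
    rw [hdata, ae_map_iff (p := fun x => x ∈ g '' Z) hG.aemeasurable hgZ]
    exact ae_of_all _ hGmem
  have hpos_mem : ∀ᵐ x ∂(pPos Z (semimetric nrm j) g), x ∈ (g '' Z) ×ˢ (g '' Z) := by
    rw [hpos, ae_map_iff (p := fun x => x ∈ (g '' Z) ×ˢ (g '' Z)) (hG.prodMap hG).aemeasurable (hgZ.prod hgZ)]
    exact ae_of_all _ fun w => ⟨hGmem _, hGmem _⟩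
  have hloss : ∀ M, contrastiveLoss Z (semimetric nrm j) g τ f M =
      ∫ s : (Rn K × Rn K) × (Fin M → Rn K), -Real.log (similarity nrm j τ F s.1 /
        (similarity nrm j τ F s.1 + ∑ i, similarity nrm j τ F (s.2 i, s.1.2)))
        ∂((pPos Z (semimetric nrm j) g).prod (Measure.pi fun _ => pData Z g)) := by
    intro M
    refine integral_congr_ae ?_
    have h2 : ∀ᵐ s ∂(Measure.pi fun _ : Fin M => pData Z g), ∀ i, s i ∈ g '' Z :=
      ae_all_iff.2 fun i =>
        (Measure.quasiMeasurePreserving_eval (fun _ : Fin M => pData Z g) i).ae hdata_mem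
    filter_upwards [Measure.quasiMeasurePreserving_fst.ae hpos_mem,
      Measure.quasiMeasurePreserving_snd.ae h2] with s h3 h4
    simp only [similarity, F, extendConst_of_mem h3.1, extendConst_of_mem h3.2,
      extendConst_of_mem (h4 _)]
  have hlim : limitLoss (uniform Z) (latentPair Z (semimetric nrm j))
      (similarity nrm j τ (extendConst Z b (f ∘ g))) =
      limitLoss (pData Z g) (pPos Z (semimetric nrm j) g) (similarity nrm j τ F) := by
    rw [hdata, hpos, limitLoss_map _ _ hG (measurable_similarity hnrm τ hF)]
    have hFG : ∀ x ∈ Z, F (G x) = extendConst Z b (f ∘ g) x := by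
      intro x hx
      rw [extendConst_of_mem hx]
      simp only [F, G, extendConst_of_mem hx, extendConst_of_mem (mem_image_of_mem g hx),
        Function.comp_apply]
    refine integral_congr_ae ?_
    filter_upwards [hPac.ae_le (Measure.quasiMeasurePreserving_fst.ae (ae_mem_uniform hZ)),
      hPac.ae_le (Measure.quasiMeasurePreserving_snd.ae (ae_mem_uniform hZ))] with w h1 h2
    have h3 : ∫ u, similarity nrm j τ (extendConst Z b (f ∘ g)) (u, w.2) ∂(uniform Z) =
        ∫ u, (similarity nrm j τ F ∘ Prod.map G G) (u, w.2) ∂(uniform Z) := by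
      refine integral_congr_ae ?_
      filter_upwards [ae_mem_uniform hZ] with u hu
      simp only [similarity, Function.comp_apply, Prod.map_apply, hFG u hu, hFG _ h2]
    rw [h3]
    simp only [similarity, Function.comp_apply, Prod.map_fst, Prod.map_snd, hFG _ h1, hFG _ h2]
  simp only [hloss, hlim]
  exact tendsto_loss_sub_log (pData Z g) (pPos Z (semimetric nrm j) g)
    (measurable_similarity hnrm τ hF) ha (haE F hFmem)

end Latent

/-! ### Differentiable approximation of encoders -/

/-- A continuous map from a compact set to a convex set is a uniform limit of differentiable maps
of the whole space to that convex set. -/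
theorem exists_differentiable_approx {E F : Type*} [NormedAddCommGroup E] [NormedSpace ℝ E]
    [FiniteDimensional ℝ E] [NormedAddCommGroup F] [NormedSpace ℝ F] {S : Set E} (hS : IsClosed S)
    {T : Set F} (hT : Convex ℝ T) (hTn : T.Nonempty) {k : E → F} (hk : ContinuousOn k S)
    (hkT : MapsTo k S T) {ε : ℝ} (hε : 0 < ε) :
    ∃ f : E → F, Differentiable ℝ f ∧ (∀ x, f x ∈ T) ∧ ∀ x ∈ S, ‖f x - k x‖ < ε := by
  -- A smooth partition of unity averages locally constant choices. Convexity of `T` and of balls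
  -- preserves both constraints; off the closed set `S` only membership in `T` is asked.
  obtain ⟨f, hf⟩ := exists_contMDiffMap_forall_mem_convex_of_local_const (modelWithCornersSelf ℝ E)
    (n := 1) (t := fun x => {c | c ∈ T ∧ (x ∈ S → c ∈ Metric.ball (k x) ε)})
    (fun x => by
      by_cases hx : x ∈ S
      · simpa [hx] using! hT.inter (convex_ball (k x) ε)
      · simpa [hx] using! hT)
    (fun x => by
      by_cases hx : x ∈ S
      · refine ⟨k x, ?_⟩
        have h1 : ∀ᶠ y in 𝓝[S] x, k y ∈ Metric.ball (k x) ε :=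
          (hk x hx).eventually_mem (Metric.ball_mem_nhds _ hε)
        filter_upwards [eventually_nhdsWithin_iff.1 h1] with y hy
        exact ⟨hkT hx, fun hyS => by
          rw [Metric.mem_ball, dist_comm]; exact hy hyS⟩
      · obtain ⟨c, hc⟩ := hTn
        refine ⟨c, ?_⟩
        filter_upwards [hS.isOpen_compl.mem_nhds hx] with y hy
        exact ⟨hc, fun hyS => (hy hyS).elim⟩)
  refine ⟨f, ?_, fun x => (hf x).1, fun x hx => mem_ball_iff_norm.1 ((hf x).2 hx)⟩
  exact f.contMDiff.contDiff.differentiable (by norm_num)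

/-! ### From minimality to the distance law -/

section Main

variable {N K : ℕ} {Z : Set (Rn N)} {nrm : Seminorm ℝ (Rn N)} {j : ℝ≥0 ≃ₜ ℝ≥0}

/-- A map that matches the ground truth rescales the semi-metric. -/
theorem semimetric_eq_of_model_eq (hnrm : ∀ x, nrm x = 0 → x = 0) (hj : j 0 = 0)
    (hZ : IsCompact Z) (hv : volume Z ≠ 0) {τ : ℝ} (hτ : 0 < τ) {h : Rn N → Rn N}
    (hh : ∀ z ∈ Z, ∀ z' ∈ Z, modelDensity Z (semimetric nrm j) τ h z z' =
      trueDensity Z (semimetric nrm j) z z') :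
    ∀ z ∈ Z, ∀ z' ∈ Z,
      semimetric nrm j (h z) (h z') = τ * semimetric nrm j z z' := by
  have := isProbabilityMeasure_uniform hZ hv
  intro z hz z' hz'
  have hC : (∫ w in Z, Real.exp (-semimetric nrm j w z')) ≠ 0 := by
    have hc : ContinuousOn (fun w => Real.exp (-semimetric nrm j w z')) Z :=
      (Real.continuous_exp.comp ((continuous_semimetric hnrm).comp
        (continuous_id.prodMk continuous_const)).neg).continuousOn
    have : 0 < ∫ w in Z, Real.exp (-semimetric nrm j w z') := by
      rw [setIntegral_pos_iff_support_of_nonneg_ae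
        (ae_of_all _ fun w => (Real.exp_pos _).le) (hc.integrableOn_compact hZ)]
      have : Function.support (fun w => Real.exp (-semimetric nrm j w z')) = univ := by
        ext w; simp [(Real.exp_pos _).ne']
      rw [this, univ_inter]
      exact pos_iff_ne_zero.2 hv
    exact this.ne'
  -- On the diagonal both exponentials are `1`, so the normalizing constants agree.
  have h1 := hh z' hz' z' hz'
  have h2 := hh z hz z' hz'
  simp only [modelDensity, trueDensity, semimetric_self hj, neg_zero, zero_div, Real.exp_zero,
    mul_one] at h1 h2
  rw [h1] at h2
  have h3 := Real.exp_injective (mul_left_cancel₀ (inv_ne_zero hC) h2)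
  field_simp at h3
  linarith

/-- If the limit loss of `h` is at most that of the ground truth, `h` rescales the semi-metric. -/
theorem semimetric_eq_of_limitLoss_le (hnrm : ∀ x, nrm x = 0 → x = 0) (hj : j 0 = 0)
    (hZ : IsCompact Z) (hv : volume Z ≠ 0) (hcl : Z ⊆ closure (interior Z)) {b : Rn N}
    (hb : b ∈ Z) {τ : ℝ} (hτ : 0 < τ) {h : Rn N → Rn N} (hc : ContinuousOn h Z)
    (hm : MapsTo h Z Z)
    (hle : limitLoss (uniform Z) (latentPair Z (semimetric nrm j))
        (similarity nrm j τ (extendConst Z b h)) ≤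
      limitLoss (uniform Z) (latentPair Z (semimetric nrm j))
        (similarity nrm j 1 (extendConst Z b id))) :
    ∀ z ∈ Z, ∀ z' ∈ Z, semimetric nrm j (h z) (h z') = τ * semimetric nrm j z z' := by
  have := isProbabilityMeasure_uniform hZ hv
  obtain ⟨a₁, ha₁, hE₁⟩ := exists_similarity_mem_Icc (j := j) hnrm hτ hZ
  obtain ⟨a₂, ha₂, hE₂⟩ := exists_similarity_mem_Icc (j := j) hnrm one_pos hZ
  have ha : 0 < min a₁ a₂ := lt_min ha₁ ha₂
  set E := similarity nrm j τ (extendConst Z b h) with hE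
  set E₀ := similarity nrm j 1 (extendConst Z b (id : Rn N → Rn N)) with hE₀
  have hEm : Measurable E := measurable_similarity hnrm τ
    (measurable_extendConst hZ.measurableSet b hc)
  have hEm₀ : Measurable E₀ := measurable_similarity hnrm 1
    (measurable_extendConst hZ.measurableSet b continuousOn_id)
  have hEI : ∀ w, E w ∈ Icc (min a₁ a₂) 1 := fun w =>
    Icc_subset_Icc_left (min_le_left _ _) (hE₁ _ (extendConst_mem hb hm) w)
  have hEI₀ : ∀ w, E₀ w ∈ Icc (min a₁ a₂) 1 := fun w =>
    Icc_subset_Icc_left (min_le_right _ _) (hE₂ _ (extendConst_mem hb (mapsTo_id Z)) w)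
  rw [latentPair_eq_withDensity hZ hv b] at hle
  have hae := simDensity_ae_eq_of_limitLoss_le _ hEm hEm₀ ha hEI hEI₀ hle
  have heq := eqOn_of_ae_eq_uniform hZ hv hcl
    (continuousOn_simDensity hZ hv hEm
      (continuousOn_similarity hnrm τ (continuousOn_extendConst b hc)) ha hEI)
    (continuousOn_simDensity hZ hv hEm₀
      (continuousOn_similarity hnrm 1 (continuousOn_extendConst b continuousOn_id)) ha hEI₀) hae
  intro z hz z' hz'
  -- The diagonal again equates the normalizing constants; this requires equality everywhere, since
  -- the diagonal may be a null set.
  have h1 := heq (x := (z', z')) ⟨hz', hz'⟩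
  have h2 := heq (x := (z, z')) ⟨hz, hz'⟩
  simp only [simDensity] at h1 h2
  rw [show E (z', z') = 1 from similarity_diag hj _ _ _,
    show E₀ (z', z') = 1 from similarity_diag hj _ _ _, mul_one, mul_one] at h1
  rw [h1] at h2
  have h3 := mul_left_cancel₀ (inv_ne_zero (integral_left_pos _ hEm₀ ha hEI₀ z').ne') h2
  have h4 := Real.exp_injective h3
  simp only [extendConst_of_mem hz, extendConst_of_mem hz', id, div_one] at h4
  field_simp at h4
  linarith

/-- A minimizer of the contrastive loss as `M → ∞` has limit loss at most that of the ground
truth. -/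
theorem limitLoss_le_of_minimizes (hnrm : ∀ x, nrm x = 0 → x = 0) (hj : j 0 = 0)
    (hZ : IsCompact Z) (hZc : Convex ℝ Z) (hv : volume Z ≠ 0) {b : Rn N} (hb : b ∈ Z)
    {X : Set (Rn K)} {g : Rn N → Rn K} (hgX : MapsTo g Z X) (hg : ContinuousOn g Z)
    (hgi : InjOn g Z) {τ : ℝ} (hτ : 0 < τ) {h₀ : Rn N → Rn N} (hm : MapsTo h₀ Z Z)
    (hh₀ : ∀ z ∈ Z, ∀ z' ∈ Z, semimetric nrm j (h₀ z) (h₀ z') = τ * semimetric nrm j z z')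
    {f : Rn K → Rn N} (hf : MinimizesLimitLoss X Z (semimetric nrm j) g τ f) :
    limitLoss (uniform Z) (latentPair Z (semimetric nrm j))
        (similarity nrm j τ (extendConst Z b (f ∘ g))) ≤
      limitLoss (uniform Z) (latentPair Z (semimetric nrm j))
        (similarity nrm j 1 (extendConst Z b id)) := by
  have hμ := isProbabilityMeasure_uniform hZ hv
  set P := latentPair Z (semimetric nrm j) with hP
  have hgXi : g '' Z ⊆ X := image_subset_iff.2 hgX
  have hle : ∀ f', IsEncoder X Z f' → limitLoss (uniform Z) P
      (similarity nrm j τ (extendConst Z b (f ∘ g))) ≤ limitLoss (uniform Z) P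
      (similarity nrm j τ (extendConst Z b (f' ∘ g))) := by
    intro f' hf'
    refine le_of_forall_pos_le_add fun ε hε => ?_
    have ht := tendsto_contrastiveLoss hnrm (j := j) hZ hv hb hg hτ
      (hf.1.2.continuousOn.mono hgXi) (hf.1.1.mono_left hgXi)
    have ht' := tendsto_contrastiveLoss hnrm (j := j) hZ hv hb hg hτ
      (hf'.2.continuousOn.mono hgXi) (hf'.1.mono_left hgXi)
    refine le_of_tendsto_of_tendsto ht (ht'.add_const ε) ?_
    filter_upwards [hf.2 f' hf' ε hε] with M hM
    linarith
  have hh₀c : ContinuousOn h₀ Z := continuousOn_of_norm_eq_rescale hnrm hj (τ := τ)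
    fun x hx y hy => norm_eq_rescale (hh₀ x hx y hy)
  have hgcl : IsClosed (g '' Z) := (hZ.image_of_continuousOn hg).isClosed
  -- The ideal encoder on `g '' Z`. It need not be differentiable, since the derivative of `g` may
  -- be singular.
  let k : Rn K → Rn N := h₀ ∘ Function.invFunOn g Z
  have hinv : ∀ z ∈ Z, Function.invFunOn g Z (g z) = z := fun z hz => hgi.leftInvOn_invFunOn hz
  -- A continuous map on a compact set sends closed subsets to closed sets, so the inverse of `g` is
  -- continuous on `g '' Z`.
  have hkc : ContinuousOn k (g '' Z) := by
    rw [continuousOn_iff_isClosed]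
    intro t ht
    obtain ⟨u, hu, hut⟩ := continuousOn_iff_isClosed.1 hh₀c t ht
    refine ⟨g '' (h₀ ⁻¹' t ∩ Z), ?_, ?_⟩
    · rw [hut]
      exact ((hZ.inter_left hu).image_of_continuousOn (hg.mono inter_subset_right)).isClosed
    · ext x
      constructor
      · rintro ⟨hx, z, hz, rfl⟩
        refine ⟨⟨z, ⟨?_, hz⟩, rfl⟩, z, hz, rfl⟩
        rw [mem_preimage] at hx ⊢
        simpa only [k, Function.comp_apply, hinv z hz] using hx
      · rintro ⟨⟨z, ⟨hzt, hz⟩, rfl⟩, hx⟩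
        refine ⟨?_, hx⟩
        rw [mem_preimage] at hzt ⊢
        simpa only [k, Function.comp_apply, hinv z hz] using hzt
  have hkZ : MapsTo k (g '' Z) Z := by
    rintro _ ⟨z, hz, rfl⟩
    simpa only [k, Function.comp_apply, hinv z hz] using hm hz
  choose F hFd hFZ hFk using fun n : ℕ => exists_differentiable_approx hgcl hZc ⟨b, hb⟩ hkc hkZ
    (Nat.one_div_pos_of_nat (α := ℝ) (n := n))
  have hFlim : ∀ z, Tendsto (fun n => extendConst Z b (F n ∘ g) z) atTop
      (𝓝 (extendConst Z b h₀ z)) := by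
    intro z
    by_cases hz : z ∈ Z
    · simp only [extendConst_of_mem hz, Function.comp_apply]
      rw [tendsto_iff_norm_sub_tendsto_zero]
      refine squeeze_zero (fun _ => norm_nonneg _) (fun n => ?_)
        tendsto_one_div_add_atTop_nhds_zero_nat
      have := (hFk n (g z) ⟨z, hz, rfl⟩).le
      simpa only [k, Function.comp_apply, hinv z hz] using this
    · classical
      simp only [extendConst, piecewise_eq_of_notMem _ _ _ hz]
      exact tendsto_const_nhds
  obtain ⟨a, ha, haE⟩ := exists_similarity_mem_Icc (j := j) hnrm hτ hZ
  obtain ⟨a₀, ha₀, haE₀⟩ := exists_similarity_mem_Icc (j := j) hnrm one_pos hZ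
  have hPp : IsProbabilityMeasure P := by
    rw [hP, latentPair_eq_withDensity hZ hv b]
    exact isProbabilityMeasure_withDensity_simDensity _
      (measurable_similarity hnrm 1 (measurable_extendConst hZ.measurableSet b continuousOn_id))
      ha₀ (haE₀ _ (extendConst_mem hb (mapsTo_id Z)))
  have hlim := tendsto_limitLoss (uniform Z) P
    (E := fun n => similarity nrm j τ (extendConst Z b (F n ∘ g)))
    (E' := similarity nrm j τ (extendConst Z b h₀))
    (fun n => measurable_similarity hnrm τ (measurable_extendConst hZ.measurableSet b
      ((hFd n).continuous.comp_continuousOn hg))) ha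
    (fun n => haE _ (extendConst_mem hb fun z _ => hFZ n _)) (haE _ (extendConst_mem hb hm))
    (fun w => Real.continuous_exp.tendsto _ |>.comp ((((continuous_semimetric hnrm).tendsto
      (extendConst Z b h₀ w.1, extendConst Z b h₀ w.2)).comp
        ((hFlim w.1).prodMk_nhds (hFlim w.2))).neg.div_const τ))
  -- The factor `τ` in the law for `h₀` cancels the temperature, so the two similarities coincide on
  -- `Z`.
  have hE : limitLoss (uniform Z) P (similarity nrm j τ (extendConst Z b h₀)) =
      limitLoss (uniform Z) P (similarity nrm j 1 (extendConst Z b id)) := by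
    have hpt : ∀ z ∈ Z, ∀ z' ∈ Z, similarity nrm j τ (extendConst Z b h₀) (z, z') =
        similarity nrm j 1 (extendConst Z b id) (z, z') := by
      intro z hz z' hz'
      simp only [similarity, extendConst_of_mem hz, extendConst_of_mem hz', hh₀ z hz z' hz', id]
      congr 1
      field_simp
    have hPac : P ≪ (uniform Z).prod (uniform Z) := by
      rw [hP, latentPair_eq_withDensity hZ hv b]
      exact withDensity_absolutelyContinuous _ _
    refine integral_congr_ae ?_
    filter_upwards [hPac.ae_le (Measure.quasiMeasurePreserving_fst.ae (ae_mem_uniform hZ)),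
      hPac.ae_le (Measure.quasiMeasurePreserving_snd.ae (ae_mem_uniform hZ))] with w h1 h2
    have h3 : ∫ u, similarity nrm j τ (extendConst Z b h₀) (u, w.2) ∂(uniform Z) =
        ∫ u, similarity nrm j 1 (extendConst Z b id) (u, w.2) ∂(uniform Z) := by
      refine integral_congr_ae ?_
      filter_upwards [ae_mem_uniform hZ] with u hu using hpt u hu _ h2
    rw [h3, hpt w.1 h1 w.2 h2]
  rw [← hE]
  exact ge_of_tendsto' hlim fun n => hle (F n)
    ⟨fun x _ => hFZ n x, (hFd n).differentiableOn⟩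

end Main

end ContrastiveICA

/-! ### Conclusion: affinity and bijectivity -/

open ContrastiveICA in
theorem theorem3 {N K : ℕ}
    (Z : ConvexBody (ContrastiveICA.Rn N)) (hZ : (interior (Z : Set (ContrastiveICA.Rn N))).Nonempty)
    (nrm : Seminorm ℝ (ContrastiveICA.Rn N)) (hnrm : ∀ x, nrm x = 0 → x = 0)
    (j : ℝ≥0 ≃ₜ ℝ≥0) (hj : j 0 = 0)
    (X : Set (ContrastiveICA.Rn K))
    (g : ContrastiveICA.Rn N → ContrastiveICA.Rn K)
    (hgX : MapsTo g Z X) (hgd : DifferentiableOn ℝ g Z) (hgi : InjOn g Z)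
    (τ : ℝ) (hτ : 0 < τ)
    (hmatch : ContrastiveICA.ModelMatches Z (ContrastiveICA.semimetric nrm j) τ)
    (f : ContrastiveICA.Rn K → ContrastiveICA.Rn N)
    (hf : ContrastiveICA.MinimizesLimitLoss X Z (ContrastiveICA.semimetric nrm j) g τ f) :
    (∃ A : ContrastiveICA.Rn N ≃ᵃ[ℝ] ContrastiveICA.Rn N, EqOn (f ∘ g) A Z) ∧
      (τ = 1 → BijOn (f ∘ g) Z Z) := by
  have hc : IsCompact (Z : Set (Rn N)) := Z.isCompact
  have hv : volume (Z : Set (Rn N)) ≠ 0 :=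
    ((isOpen_interior.measure_pos volume hZ).trans_le (measure_mono interior_subset)).ne'
  have hcl : (Z : Set (Rn N)) ⊆ closure (interior (Z : Set (Rn N))) := by
    rw [Z.convex.closure_interior_eq_closure_of_nonempty_interior hZ]
    exact subset_closure
  obtain ⟨b, hb⟩ := Z.nonempty
  obtain ⟨h₀, hm₀, hh₀⟩ := hmatch
  have hm : MapsTo (f ∘ g) Z Z := hf.1.1.comp hgX
  have hd : DifferentiableOn ℝ (f ∘ g) Z := hf.1.2.comp hgd hgX
  have hδ := semimetric_eq_of_limitLoss_le hnrm hj hc hv hcl hb hτ hd.continuousOn hm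
    (limitLoss_le_of_minimizes hnrm hj hc Z.convex hv hb hgX hgd.continuousOn hgi hτ hm₀
      (semimetric_eq_of_model_eq hnrm hj hc hv hτ hh₀) hf)
  have hi : InjOn (f ∘ g) Z := by
    intro z hz z' hz' hzz
    have h1 := hδ z hz z' hz'
    rw [hzz, semimetric_self hj, eq_comm, mul_eq_zero] at h1
    exact eq_of_semimetric_eq_zero hnrm hj (h1.resolve_left hτ.ne')
  have hφ : ∀ z ∈ (Z : Set (Rn N)), ∀ z' ∈ (Z : Set (Rn N)),
      nrm ((f ∘ g) z - (f ∘ g) z') = rescale j τ (nrm (z - z')) :=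
    fun z hz z' hz' => norm_eq_rescale (hδ z hz z' hz')
  refine ⟨?_, fun h1 => ⟨hm, hi, ?_⟩⟩
  · obtain ⟨A, hA⟩ := exists_affineEquiv_of_seminorm_sub_eq nrm hnrm isOpen_interior
      Z.convex.interior hZ (hd.mono interior_subset) (hi.mono interior_subset)
      fun x hx y hy => hφ x (interior_subset hx) y (interior_subset hy)
    -- The affine identity is proved on the interior, where derivatives are two-sided, and passes to
    -- the boundary by continuity.
    exact ⟨A, hA.of_subset_closure hd.continuousOn
      A.continuous_of_finiteDimensional.continuousOn interior_subset hcl⟩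
  · refine surjOn_of_seminorm_sub_eq hnrm hc hm fun x hx y hy => ?_
    rw [hφ x hx y hy, h1, rescale_one (apply_nonneg nrm _)]
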